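/- Let $p$ be an odd prime. For $\varepsilon\in\mathbb R$ let $e_\varepsilon\colon S^1\to\mathbb R^2$ be the map that sends the point of $S^1$ with angle $\varphi$ to the point with polar coordinates $(r,\varphi)$, $r=1-\varepsilon\cos(p\varphi)$. On $(S^1)^p$ consider the perimeter function of inscribed closed $p$-gons $$f_\varepsilon(x_1,\dots,x_p)=\sum_{i\in\mathbb Z/p}\|e_\varepsilon(x_i)-e_\varepsilon(x_{i+1})\|,$$ which is invariant under the dihedral group $D_p$ acting on $(S^1)^p$ by cyclic shifts and reflections of the indices. Let $\Delta$ be the set of those $(x_1,\dots,x_p)$ with $x_i=x_{i+1}$ for some $i\in\mathbb Z/p$, where $f_\varepsilon$ is not smooth. Critical points of $f_\varepsilon$ are understood to lie outside $\Delta$ and are counted in the quotient $(S^1)^p/D_p$. Then there is $\varepsilon_0>0$ (depending on $p$) such that for every $\varepsilon$ with $0<\varepsilon<\varepsilon_0$ the map $e_\varepsilon$ is a smooth embedding, every critical point of $f_\varepsilon$ is nondegenerate, and $f_\varepsilon$ has exactly $p-1$ critical points up to the action of $D_p$: exactly $\frac{p-1}{2}$ of them are local maxima and exactly $\frac{p-1}{2}$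 of them have Morse index $p-1$. -/

import Mathlib

open scoped ContDiff Manifold

noncomputable section

namespace Billiard

/-- The Euclidean plane. -/
abbrev Plane : Type := EuclideanSpace ℝ (Fin 2)

/-- The map of the unit circle to the plane whose image is the curve `r = 1 - ε cos (p φ)` in polar
coordinates: for `z = exp (i φ)` one has `Re (z ^ p) = cos (p φ)`, `Re z = cos φ`, `Im z = sin φ`
(see `deformedCircle_exp`). -/
def deformedCircle (p : ℕ) (ε : ℝ) (z : Circle) : Plane :=
  (1 - ε * ((z : ℂ) ^ p).re) • !₂[(z : ℂ).re, (z : ℂ).im]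

/-- `deformedCircle p ε` sends the point of the circle with polar angle `φ` to the point of the
plane with polar coordinates `(1 - ε cos (p φ), φ)`. -/
theorem deformedCircle_exp (p : ℕ) (ε φ : ℝ) :
    deformedCircle p ε (Circle.exp φ) =
      !₂[(1 - ε * Real.cos (p * φ)) * Real.cos φ, (1 - ε * Real.cos (p * φ)) * Real.sin φ] := by
  have h : (Complex.exp (φ * Complex.I) ^ p).re = Real.cos (p * φ) := by
    rw [← Complex.exp_nat_mul, ← mul_assoc]
    have := Complex.exp_ofReal_mul_I_re (p * φ)
    push_cast at this
    exact this
  ext i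
  fin_cases i
  · simp [deformedCircle, h, Circle.coe_exp, Complex.exp_ofReal_mul_I_re]
  · simp [deformedCircle, h, Circle.coe_exp, Complex.exp_ofReal_mul_I_im]

/-- A closed `p`-gon with vertices on a parametrized closed curve, given by the parameters of its
cyclically ordered vertices: a point of the torus `(S¹)^p`. -/
abbrev Polygon (p : ℕ) : Type := ZMod p → Circle

/-- The action of the dihedral group `D_p` on `(S¹)^p` by cyclic shifts and reflections of the
indices, as an equivalence relation: two polygons are equivalent if they are in one orbit. -/
def dihedralSetoid (p : ℕ) : Setoid (Polygon p) where
  r x y := ∃ a : ZMod p, (∀ i, y i = x (i + a)) ∨ (∀ i, y i = x (a - i))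
  iseqv :=
    { refl := fun x => ⟨0, Or.inl fun i => by rw [add_zero]⟩
      symm := by
        rintro x y ⟨a, h | h⟩
        · exact ⟨-a, Or.inl fun i => by rw [h, neg_add_cancel_right]⟩
        · exact ⟨a, Or.inr fun i => by rw [h, sub_sub_cancel]⟩
      trans := by
        rintro x y z ⟨a, h | h⟩ ⟨b, k | k⟩
        · exact ⟨b + a, Or.inl fun i => by rw [k, h, add_assoc]⟩
        · exact ⟨b + a, Or.inr fun i => by rw [k, h, sub_add_eq_add_sub]⟩
        · exact ⟨a - b, Or.inr fun i => by rw [k, h, sub_sub, add_comm i b]⟩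
        · exact ⟨a - b, Or.inl fun i => by rw [k, h]; congr 1; abel⟩ }

/-- The quotient `(S¹)^p / D_p`. -/
abbrev PolygonClass (p : ℕ) : Type := Quotient (dihedralSetoid p)

/-- The perimeter `f(x) = ∑_{i ∈ ℤ/p} ‖e(x_i) - e(x_{i+1})‖` of the closed polygon `x` inscribed in
the closed plane curve `e`. -/
def perimeter {p : ℕ} [NeZero p] (e : Circle → Plane) (x : Polygon p) : ℝ :=
  ∑ i : ZMod p, dist (e (x i)) (e (x (i + 1)))

/-- The perimeter descends to `(S¹)^p / D_p`. -/
theorem perimeter_eq_of_rel {p : ℕ} [NeZero p] (e : Circle → Plane) {x y : Polygon p}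
    (h : (dihedralSetoid p).r x y) : perimeter e x = perimeter e y := by
  obtain ⟨a, h | h⟩ := h
  · simp only [perimeter, h]
    refine (Fintype.sum_equiv (Equiv.addRight a) _ _ fun i => ?_).symm
    simp only [Equiv.coe_addRight]
    rw [add_right_comm]
  · simp only [perimeter, h]
    refine (Fintype.sum_equiv (Equiv.subLeft (a - 1)) _ _ fun i => ?_).symm
    simp only [Equiv.subLeft_apply]
    rw [dist_comm]
    congr 3 <;> abel

/-- The set `Δ ⊆ (S¹)^p` of polygons with two equal consecutive vertices. -/
def diagonal (p : ℕ) : Set (Polygon p) :=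
  {x | ∃ i, x i = x (i + 1)}

/-- The perimeter near the polygon `x`, written in the angular coordinates `t ∈ ℝ^p` centred at `x`:
the vertex `x i` is rotated by the angle `t i`. The map `t ↦ (x i * exp (i t_i))_i` is a local
diffeomorphism from `ℝ^p` to `(S¹)^p`, which sends `0` to `x`. -/
def localPerimeter {p : ℕ} [NeZero p] (e : Circle → Plane) (x : Polygon p) (t : ZMod p → ℝ) : ℝ :=
  perimeter e fun i => x i * Circle.exp (t i)

/-- `x ∈ (S¹)^p ∖ Δ` is a critical point of the perimeter. -/
def IsCriticalPolygon {p : ℕ} [NeZero p] (e : Circle → Plane) (x : Polygon p) : Prop :=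
  x ∉ diagonal p ∧ HasFDerivAt (localPerimeter e x) (0 : (ZMod p → ℝ) →L[ℝ] ℝ) 0

/-- The Hessian of the perimeter at `x` in angular coordinates; at a critical point its rank and
index do not depend on the coordinates. -/
def hessian {p : ℕ} [NeZero p] (e : Circle → Plane) (x : Polygon p) :
    (ZMod p → ℝ) →L[ℝ] (ZMod p → ℝ) →L[ℝ] ℝ :=
  fderiv ℝ (fderiv ℝ (localPerimeter e x)) 0

/-- The Hessian at `x` is a nondegenerate bilinear form. -/
def IsNondegenerate {p : ℕ} [NeZero p] (e : Circle → Plane) (x : Polygon p) : Prop :=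
  ∀ v, (∀ w, hessian e x v w = 0) → v = 0

/-- The Morse index at `x`: the largest dimension of a linear subspace on which the Hessian is
negative definite. -/
def morseIndex {p : ℕ} [NeZero p] (e : Circle → Plane) (x : Polygon p) : ℕ :=
  sSup {d | ∃ W : Submodule ℝ (ZMod p → ℝ),
    Module.finrank ℝ W = d ∧ ∀ v ∈ W, v ≠ 0 → hessian e x v v < 0}

/-- The critical points of the perimeter with the property `P`, as points of `(S¹)^p / D_p`. -/
def criticalClasses {p : ℕ} [NeZero p] (e : Circle → Plane) (P : Polygon p → Prop) :
    Set (PolygonClass p) :=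
  Quotient.mk (dihedralSetoid p) '' {x | IsCriticalPolygon e x ∧ P x}

end Billiard

end

/-! The plan is to lift polygons to angles, understand the circle completely at `ε = 0`, and
perturb. A polygon outside the diagonal has consecutive angle differences in `(0, 2π)` whose sum is
`2π` times an integer strictly between `0` and `p`. This integer is a nonzero class `k` modulo `p`,
and the polygon is `starPolygon k s`: the regular star polygon of winding number `k`, with its
vertices displaced by angles `s i`. The curve is invariant under rotation by `2π/p`, so its radius
at the `i`-th vertex depends on `s i` alone. The perimeter becomes `liftedPerimeter k ε s`,
invariant under cyclic shifts of `s`.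

Ordinary chord length is not smooth where a chord degenerates. `chordLength_sq` shows that the
squared length is divisible by the squared sine of half the angle difference; the signed square root
is then smooth across degenerate chords, jointly with `ε`. This makes a compactness argument
possible on the closed domain of lifts, with no separate analysis near the diagonal.

At `ε = 0` the only critical lifts in this domain are constant, and at them the Hessian is negative
definite on the vectors of coordinate sum zero. For every `ε` with `|ε| < 1`, cyclic symmetry makes
the differential at a constant lift a multiple of the coordinate sum, so it vanishes on those
vectors. If a critical lift for small `ε` were not constant, it would be close to its average;
Rolle's theorem on the segment joining the two would give a zero of the second derivative in a
sum-zero direction, contradicting negativity (`eventually_critical_const`).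

The critical polygons are thus the regular ones with `sin (p c) = 0`. The vector `1` is an
eigenvector of the Hessian, and its eigenvalue has the sign of `cos (p c)`: the value `-1` gives
local maxima, the value `1` gives index `p - 1`. Up to the dihedral group, a regular polygon is
determined by `k` up to sign and by `exp (i p c)`, which leaves `(p - 1) / 2` classes of each kind.
-/

noncomputable section

namespace Billiard

/-! ### The deformed circle is smoothly embedded. -/

section

open Complex in
/-- The angular chart of the circle centred at `z₀`. -/
def circleChart (z₀ : Circle) : OpenPartialHomeomorph Circle (EuclideanSpace ℝ (Fin 1)) where
  toFun z := WithLp.toLp 2 fun _ => arg ((z / z₀ : Circle) : ℂ)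
  invFun u := z₀ * Circle.exp (u 0)
  source := {z | ((z / z₀ : Circle) : ℂ) ∈ slitPlane}
  target := {u | u 0 ∈ Set.Ioo (-Real.pi) Real.pi}
  map_source' z hz := ⟨neg_pi_lt_arg _, lt_of_le_of_ne (arg_le_pi _) (mem_slitPlane_iff_arg.1 hz).1⟩
  map_target' u hu := by
    have : Circle.exp (u 0) = z₀ * Circle.exp (u 0) / z₀ := by simp
    rw [Set.mem_ofPred_eq, ← this, mem_slitPlane_iff_arg, Circle.arg_exp hu.1 hu.2.le]
    exact ⟨hu.2.ne, by simp⟩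
  left_inv' z hz := by simp only [Circle.exp_arg, mul_div_cancel]
  right_inv' u hu := by
    ext i
    fin_cases i
    simp [Circle.arg_exp hu.1 hu.2.le, -Circle.coe_exp]
  open_source := isOpen_slitPlane.preimage (by fun_prop)
  open_target := isOpen_Ioo.preimage (by fun_prop)
  continuousOn_toFun := by
    refine (PiLp.continuous_toLp 2 _).comp_continuousOn ?_
    refine continuousOn_pi.2 fun _ z hz => ContinuousAt.continuousWithinAt ?_
    refine (continuousAt_arg hz).comp (f := fun z : Circle => ((z / z₀ : Circle) : ℂ)) ?_
    fun_prop
  continuousOn_invFun := by fun_prop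

theorem contDiffAt_arg {n : ℕ∞ω} {w : ℂ} (hw : w ∈ Complex.slitPlane) :
    ContDiffAt ℝ n Complex.arg w := by
  have h : ContDiffAt ℝ n Complex.log w := (Complex.contDiffAt_log hw).restrict_scalars ℝ
  exact (Complex.imCLM.contDiff.contDiffAt.comp w h).congr_of_eventuallyEq
    (Filter.Eventually.of_forall fun z => by simp [Complex.log_im])

theorem contMDiff_coe_circle : ContMDiff (𝓡 1) 𝓘(ℝ, ℂ) ∞ (fun z : Circle => (z : ℂ)) := by
  have : Fact (Module.finrank ℝ ℂ = 1 + 1) := Complex.finrank_real_complex_fact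
  exact contMDiff_coe_sphere (E := ℂ) (n := 1)

theorem circleChart_mem_maximalAtlas (z₀ : Circle) :
    circleChart z₀ ∈ IsManifold.maximalAtlas (𝓡 1) ∞ Circle := by
  have : IsManifold (𝓡 1) ∞ Circle := .of_le (n := ω) le_top
  have : LieGroup (𝓡 1) ∞ Circle := .of_le (n := ω) le_top
  apply OpenPartialHomeomorph.mem_maximalAtlas_of_contMDiffOn
  · have h : ∀ w : ℂ, w ∈ Complex.slitPlane → ContDiffAt ℝ ∞
        (fun w : ℂ => (WithLp.toLp 2 fun _ => Complex.arg w : EuclideanSpace ℝ (Fin 1))) w :=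
      fun w hw => contDiffAt_piLp' _ fun _ => contDiffAt_arg hw
    intro z hz
    refine ContMDiffAt.contMDiffWithinAt ?_
    have h2 : ContMDiffAt (𝓡 1) 𝓘(ℝ, ℂ) ∞ (fun z : Circle => ((z / z₀ : Circle) : ℂ)) z :=
      (contMDiff_coe_circle.comp
        ((contMDiff_id (I := 𝓡 1) (M := Circle)).div contMDiff_const)).contMDiffAt
    exact ContMDiffAt.comp (g := fun w : ℂ =>
      (WithLp.toLp 2 fun _ => Complex.arg w : EuclideanSpace ℝ (Fin 1))) z (h _ hz).contMDiffAt h2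
  · refine ContMDiff.contMDiffOn ?_
    refine contMDiff_const.mul (contMDiff_circleExp.comp ?_)
    exact ContDiff.contMDiff (by fun_prop)

/-- The isometry of the complex plane with the Euclidean plane. -/
def planeOfComplex : ℂ ≃L[ℝ] Plane :=
  Complex.orthonormalBasisOneI.repr.toContinuousLinearEquiv

theorem planeOfComplex_apply (z : ℂ) : planeOfComplex z = !₂[z.re, z.im] := by
  ext i
  fin_cases i <;> simp [planeOfComplex]

theorem norm_planeOfComplex (z : ℂ) : ‖planeOfComplex z‖ = ‖z‖ :=
  Complex.orthonormalBasisOneI.repr.norm_map z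

/-- The polar radius of the deformed circle. -/
def radius (p : ℕ) (ε : ℝ) (z : Circle) : ℝ := 1 - ε * ((z : ℂ) ^ p).re

theorem deformedCircle_eq (p : ℕ) (ε : ℝ) (z : Circle) :
    deformedCircle p ε z = planeOfComplex ((radius p ε z : ℂ) * z) := by
  rw [deformedCircle, planeOfComplex_apply]
  ext i
  fin_cases i <;> simp only [radius] <;> simp

theorem abs_re_pow_le (p : ℕ) (z : Circle) : |((z : ℂ) ^ p).re| ≤ 1 :=
  (Complex.abs_re_le_norm _).trans (by rw [norm_pow, Circle.norm_coe, one_pow])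

theorem radius_pos (p : ℕ) {ε : ℝ} (hε : |ε| < 1) (z : Circle) : 0 < radius p ε z := by
  have h : |ε * ((z : ℂ) ^ p).re| < 1 := by
    rw [abs_mul]
    nlinarith [abs_re_pow_le p z, abs_nonneg ε, abs_nonneg ((z : ℂ) ^ p).re]
  rw [radius]
  linarith [(abs_lt.1 h).2]

theorem contDiff_radius_exp (p : ℕ) (ε : ℝ) (z : Circle) :
    ContDiff ℝ ∞ fun b : ℝ => radius p ε (z * Circle.exp b) := by
  have : ContDiff ℝ ∞ fun b : ℝ => ((z : ℂ) * Complex.exp (b * Complex.I)) ^ p := by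
    have : ContDiff ℝ ∞ fun b : ℝ => (b : ℂ) := Complex.ofRealCLM.contDiff
    fun_prop
  simp only [radius, Circle.coe_mul, Circle.coe_exp]
  exact contDiff_const.sub (contDiff_const.mul (Complex.reCLM.contDiff.comp this))

theorem continuous_deformedCircle (p : ℕ) (ε : ℝ) : Continuous (deformedCircle p ε) := by
  have : deformedCircle p ε = fun z => planeOfComplex ((radius p ε z : ℂ) * z) :=
    funext (deformedCircle_eq p ε)
  rw [this]
  simp only [radius]
  fun_prop

theorem injective_deformedCircle (p : ℕ) {ε : ℝ} (hε : |ε| < 1) :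
    Function.Injective (deformedCircle p ε) := by
  intro z w h
  rw [deformedCircle_eq, deformedCircle_eq] at h
  replace h := planeOfComplex.injective h
  have hn := congrArg norm h
  simp only [norm_mul, Circle.norm_coe, Complex.norm_real, Real.norm_eq_abs,
    abs_of_pos (radius_pos p hε _), mul_one] at hn
  rw [hn] at h
  exact Circle.ext (mul_left_cancel₀ (by exact_mod_cast (radius_pos p hε w).ne') h)

/-- A linear identification of the chart range times the normal direction with the plane. -/
def planeSplitting : (EuclideanSpace ℝ (Fin 1) × ℝ) ≃L[ℝ] Plane :=
  ContinuousLinearEquiv.ofFinrankEq (by simp)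

open Complex in
/-- Logarithmic polar coordinates centred at the direction `z₀`, sheared so that the deformed circle
becomes a line. -/
def radialFun (p : ℕ) (ε : ℝ) (z₀ : Circle) (w : Plane) : Plane :=
  planeSplitting (WithLp.toLp 2 fun _ => arg (planeOfComplex.symm w / z₀),
    (log (planeOfComplex.symm w / z₀)).re -
      Real.log (radius p ε (z₀ * Circle.exp (arg (planeOfComplex.symm w / z₀)))))

open Complex in
/-- The inverse of `radialFun`. -/
def radialInv (p : ℕ) (ε : ℝ) (z₀ : Circle) (y : Plane) : Plane :=
  planeOfComplex (z₀ * exp (((planeSplitting.symm y).2 + Real.log (radius p ε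
      (z₀ * Circle.exp ((planeSplitting.symm y).1 0))) : ℝ) + ((planeSplitting.symm y).1 0 : ℝ) * I))

theorem contDiff_log_radius (p : ℕ) {ε : ℝ} (hε : |ε| < 1) (z₀ : Circle) :
    ContDiff ℝ ∞ fun b : ℝ => Real.log (radius p ε (z₀ * Circle.exp b)) :=
  (contDiff_radius_exp p ε z₀).log fun _ => (radius_pos p hε _).ne'

theorem contDiffAt_radialFun (p : ℕ) {ε : ℝ} (hε : |ε| < 1) (z₀ : Circle) {w : Plane}
    (hw : planeOfComplex.symm w / z₀ ∈ Complex.slitPlane) :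
    ContDiffAt ℝ ∞ (radialFun p ε z₀) w := by
  have h1 : ContDiff ℝ ∞ fun w : Plane => planeOfComplex.symm w / z₀ := by
    simp only [div_eq_mul_inv]
    exact planeOfComplex.symm.contDiff.mul contDiff_const
  have h2 : ContDiffAt ℝ ∞ (fun w : Plane => Complex.arg (planeOfComplex.symm w / z₀)) w :=
    ContDiffAt.comp (g := Complex.arg) w (contDiffAt_arg hw) h1.contDiffAt
  have h3 : ContDiffAt ℝ ∞ (fun w : Plane => Complex.log (planeOfComplex.symm w / z₀)) w :=
    ContDiffAt.comp (g := Complex.log) w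
      ((Complex.contDiffAt_log hw).restrict_scalars ℝ) h1.contDiffAt
  refine planeSplitting.contDiff.contDiffAt.comp w (ContDiffAt.prodMk ?_ ?_)
  · exact contDiffAt_piLp' _ fun _ => h2
  · exact (Complex.reCLM.contDiff.contDiffAt.comp w h3).sub
      ((contDiff_log_radius p hε z₀).contDiffAt.comp w h2)

theorem contDiff_radialInv (p : ℕ) {ε : ℝ} (hε : |ε| < 1) (z₀ : Circle) :
    ContDiff ℝ ∞ (radialInv p ε z₀) := by
  have h1 : ContDiff ℝ ∞ fun y : Plane => (planeSplitting.symm y).1 0 :=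
    (contDiff_piLp_apply 2).comp (contDiff_fst.comp planeSplitting.symm.contDiff)
  have h2 : ContDiff ℝ ∞ fun y : Plane => (planeSplitting.symm y).2 :=
    contDiff_snd.comp planeSplitting.symm.contDiff
  refine planeOfComplex.contDiff.comp (contDiff_const.mul (ContDiff.cexp (ContDiff.add ?_ ?_)))
  · exact Complex.ofRealCLM.contDiff.comp (h2.add ((contDiff_log_radius p hε z₀).comp h1))
  · exact (Complex.ofRealCLM.contDiff.comp h1).mul contDiff_const

open Complex in
/-- The chart of the plane in logarithmic polar coordinates, centred at the direction `z₀` and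
sheared so that the deformed circle becomes a line. -/
def radialChart (p : ℕ) {ε : ℝ} (hε : |ε| < 1) (z₀ : Circle) :
    OpenPartialHomeomorph Plane Plane where
  toFun := radialFun p ε z₀
  invFun := radialInv p ε z₀
  source := {w | planeOfComplex.symm w / z₀ ∈ slitPlane}
  target := {y | (planeSplitting.symm y).1 0 ∈ Set.Ioo (-Real.pi) Real.pi}
  map_source' w hw := by
    simpa [radialFun] using
      ⟨neg_pi_lt_arg _, lt_of_le_of_ne (arg_le_pi _) (mem_slitPlane_iff_arg.1 hw).1⟩
  map_target' y hy := by
    simp only [Set.mem_ofPred_eq] at hy ⊢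
    rw [radialInv, ContinuousLinearEquiv.symm_apply_apply, mul_div_cancel_left₀ _ z₀.coe_ne_zero]
    refine expOpenPartialHomeomorph.map_source ?_
    simpa [expOpenPartialHomeomorph] using hy
  left_inv' w hw := by
    have h0 : planeOfComplex.symm w / z₀ ≠ 0 := slitPlane_ne_zero hw
    simp only [radialFun, radialInv, ContinuousLinearEquiv.symm_apply_apply, sub_add_cancel]
    have : ((log (planeOfComplex.symm w / z₀)).re : ℂ) + (arg (planeOfComplex.symm w / z₀) : ℂ) * I
        = log (planeOfComplex.symm w / z₀) := by
      rw [← log_im, re_add_im]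
    rw [this, exp_log h0, mul_div_cancel₀ _ z₀.coe_ne_zero, ContinuousLinearEquiv.apply_symm_apply]
  right_inv' y hy := by
    simp only [Set.mem_ofPred_eq] at hy
    have hl : ∀ a : ℝ, log (exp (a + ((planeSplitting.symm y).1 0 : ℝ) * I))
        = a + ((planeSplitting.symm y).1 0 : ℝ) * I := fun a =>
      log_exp (by simpa using hy.1) (by simpa using hy.2.le)
    have ha : ∀ a : ℝ, arg (exp (a + ((planeSplitting.symm y).1 0 : ℝ) * I))
        = (planeSplitting.symm y).1 0 := fun a => by
      rw [← log_im, hl]; simp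
    simp only [radialFun, radialInv, ContinuousLinearEquiv.symm_apply_apply,
      mul_div_cancel_left₀ _ z₀.coe_ne_zero, ha, hl]
    rw [← planeSplitting.eq_symm_apply]
    ext i
    · fin_cases i; simp
    · simp
  open_source := isOpen_slitPlane.preimage (by fun_prop)
  open_target := isOpen_Ioo.preimage (by fun_prop)
  continuousOn_toFun w hw := (contDiffAt_radialFun p hε z₀ hw).continuousAt.continuousWithinAt
  continuousOn_invFun := (contDiff_radialInv p hε z₀).continuous.continuousOn

theorem radialChart_mem_maximalAtlas (p : ℕ) {ε : ℝ} (hε : |ε| < 1) (z₀ : Circle) :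
    radialChart p hε z₀ ∈ IsManifold.maximalAtlas 𝓘(ℝ, Plane) ∞ Plane := by
  apply OpenPartialHomeomorph.mem_maximalAtlas_of_contMDiffOn
  · exact fun w hw => (contDiffAt_radialFun p hε z₀ hw).contMDiffAt.contMDiffWithinAt
  · exact (contDiff_radialInv p hε z₀).contMDiff.contMDiffOn

/-- The shear subtracts the logarithm of the radius of the curve, so the second coordinate vanishes
along the curve; this is the local normal form of an immersion. -/
theorem radialFun_deformedCircle (p : ℕ) {ε : ℝ} (hε : |ε| < 1) (z₀ : Circle)
    {u : EuclideanSpace ℝ (Fin 1)} (hu : u 0 ∈ Set.Ioo (-Real.pi) Real.pi) :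
    radialFun p ε z₀ (deformedCircle p ε (z₀ * Circle.exp (u 0))) = planeSplitting (u, 0) := by
  have hr := radius_pos p hε (z₀ * Circle.exp (u 0))
  have h : planeOfComplex.symm (deformedCircle p ε (z₀ * Circle.exp (u 0))) / z₀ =
      (radius p ε (z₀ * Circle.exp (u 0)) : ℂ) * (Circle.exp (u 0) : ℂ) := by
    rw [deformedCircle_eq, ContinuousLinearEquiv.symm_apply_apply, Circle.coe_mul]
    field_simp [z₀.coe_ne_zero]
  have ha : Complex.arg ((radius p ε (z₀ * Circle.exp (u 0)) : ℂ) * (Circle.exp (u 0) : ℂ)) =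
      u 0 := by
    rw [Complex.arg_real_mul _ hr, Circle.arg_exp hu.1 hu.2.le]
  rw [radialFun, h, ha, Complex.log_re, norm_mul, Circle.norm_coe, Complex.norm_real,
    Real.norm_of_nonneg hr.le, mul_one, sub_self]
  congr 2
  ext i
  fin_cases i
  rfl

/-- The charts give the immersion, and a continuous injection of a compact space into a Hausdorff
space is a closed embedding. -/
theorem isSmoothEmbedding_deformedCircle (p : ℕ) {ε : ℝ} (hε : |ε| < 1) :
    Manifold.IsSmoothEmbedding (𝓡 1) 𝓘(ℝ, Plane) ∞ (deformedCircle p ε) := by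
  refine ⟨Manifold.IsImmersionOfComplement.isImmersion (F := ℝ) fun z₀ => ?_,
    (Continuous.isClosedEmbedding (continuous_deformedCircle p ε)
      (injective_deformedCircle p hε)).isEmbedding⟩
  refine .mk_of_continuousAt (continuous_deformedCircle p ε).continuousAt planeSplitting
    (circleChart z₀) (radialChart p hε z₀) ?_ ?_ (circleChart_mem_maximalAtlas z₀)
    (radialChart_mem_maximalAtlas p hε z₀) ?_
  · simp [circleChart]
  · simp [radialChart, deformedCircle_eq, Complex.mem_slitPlane_iff, radius_pos p hε]
  · intro u hu
    have hu : u 0 ∈ Set.Ioo (-Real.pi) Real.pi := by simpa [circleChart] using hu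
    simpa [radialChart, circleChart] using radialFun_deformedCircle p hε z₀ hu

end

/-! ### Signed chord lengths and the lifted perimeter. -/

section

open Real Polynomial.Chebyshev

/-- The signed length of a chord of the curve `r = 1 - ε cos (p φ)` with endpoints at the angles
`α + a` and `α + β + b`, where `p α` and `p β` are multiples of `2 π`. It is smooth where the chord
degenerates. -/
def chordLength (p : ℕ) (β ε a b : ℝ) : ℝ :=
  2 * sin ((β + b - a) / 2) * √((1 - ε * cos (p * a)) * (1 - ε * cos (p * b)) +
    (ε * sin (p * (a + b) / 2) * (U ℝ (p - 1)).eval (cos ((β + b - a) / 2))) ^ 2)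

theorem radius_polar_pos {ε : ℝ} (hε : |ε| < 1) (x : ℝ) : 0 < 1 - ε * cos x := by
  have h : |ε * cos x| < 1 := by
    rw [abs_mul]
    nlinarith [abs_cos_le_one x, abs_nonneg ε, abs_nonneg (cos x)]
  linarith [(abs_lt.1 h).2]

theorem chordLength_radicand_pos (p : ℕ) {ε : ℝ} (hε : |ε| < 1) (a b c : ℝ) :
    0 < (1 - ε * cos (p * a)) * (1 - ε * cos (p * b)) + c ^ 2 :=
  add_pos_of_pos_of_nonneg (mul_pos (radius_polar_pos hε _) (radius_polar_pos hε _)) (sq_nonneg _)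

theorem contDiffAt_chordLength (p : ℕ) (β : ℝ) {q : ℝ × ℝ × ℝ} (hq : |q.1| < 1) :
    ContDiffAt ℝ ∞ (fun q : ℝ × ℝ × ℝ => chordLength p β q.1 q.2.1 q.2.2) q := by
  have hU : ContDiff ℝ ∞ fun x : ℝ => (U ℝ (p - 1)).eval x := by
    simpa using (U ℝ (p - 1)).contDiff_aeval (𝕜 := ℝ) ∞
  unfold chordLength
  refine ContDiffAt.mul (by fun_prop) (ContDiffAt.sqrt (ContDiff.contDiffAt ?_)
    (chordLength_radicand_pos p hq _ _ _).ne')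
  have : ContDiff ℝ ∞ fun q : ℝ × ℝ × ℝ => (U ℝ (p - 1)).eval (cos ((β + q.2.2 - q.2.1) / 2)) :=
    hU.comp (by fun_prop)
  fun_prop

/-- The right side is the law of cosines. With radii `r, r'` and angle `θ = β + b - a` it equals `(r
- r')² + 4 r r' sin² (θ/2)`. The difference of radii contains the factor `sin (p (b - a) / 2)`,
which is `± sin (p θ / 2)` because `p β` is a multiple of `2π`, and hence is divisible by `sin
(θ/2)` with a Chebyshev polynomial as quotient. -/
theorem chordLength_sq {p : ℕ} {β ε : ℝ} (a b : ℝ) (hε : |ε| < 1) {m : ℕ} (hβ : p * β = 2 * π * m) :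
    chordLength p β ε a b ^ 2 = (1 - ε * cos (p * a)) ^ 2 + (1 - ε * cos (p * b)) ^ 2 -
      2 * (1 - ε * cos (p * a)) * (1 - ε * cos (p * b)) * cos (β + b - a) := by
  have hU : (U ℝ (p - 1)).eval (cos ((β + b - a) / 2)) * sin ((β + b - a) / 2)
      = sin (m * π + p * (b - a) / 2) := by
    rw [U_real_cos]
    congr 1
    push_cast
    linear_combination hβ / 2
  -- The shift by `m π` changes only the sign, which the square removes.
  have hs : sin (m * π + p * (b - a) / 2) ^ 2 = sin (p * (b - a) / 2) ^ 2 := by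
    rw [sin_add, sin_nat_mul_pi, zero_mul, zero_add, mul_pow, cos_nat_mul_pi, ← pow_mul,
      mul_comm m, pow_mul]
    norm_num
  have hc : cos (p * b) - cos (p * a) = -2 * sin (p * (a + b) / 2) * sin (p * (b - a) / 2) := by
    rw [cos_sub_cos]
    ring_nf
  have hh : cos (β + b - a) = 1 - 2 * sin ((β + b - a) / 2) ^ 2 := by
    have := cos_two_mul ((β + b - a) / 2)
    rw [mul_div_cancel₀ _ two_ne_zero] at this
    rw [this, cos_sq']
    ring
  rw [chordLength, mul_pow, sq_sqrt (chordLength_radicand_pos p hε _ _ _).le, hh]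
  linear_combination (4 * ε ^ 2 * sin (p * (a + b) / 2) ^ 2) *
      (congrArg (· ^ 2) hU).trans hs -
    ε ^ 2 * (cos (p * b) - cos (p * a) - 2 * sin (p * (a + b) / 2) * sin (p * (b - a) / 2)) * hc

theorem chordLength_pos {p : ℕ} {β ε a b : ℝ} (hε : |ε| < 1) (h0 : 0 < β + b - a)
    (h1 : β + b - a < 2 * π) : 0 < chordLength p β ε a b :=
  mul_pos (mul_pos two_pos (sin_pos_of_pos_of_lt_pi (by linarith) (by linarith)))
    (sqrt_pos.2 (chordLength_radicand_pos p hε _ _ _))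

theorem chordLength_zero (p : ℕ) (β a b : ℝ) :
    chordLength p β 0 a b = 2 * sin ((β + b - a) / 2) := by
  simp [chordLength]

/-- The two radii agree, so the chord is the base of an isosceles triangle with apex angle `β`. -/
theorem chordLength_diag {p : ℕ} {β ε : ℝ} (a : ℝ) (hε : |ε| < 1) {m : ℕ}
    (hβ : p * β = 2 * π * m) (h0 : 0 < β) (h1 : β < 2 * π) :
    chordLength p β ε a a = 2 * sin (β / 2) * (1 - ε * cos (p * a)) := by
  have hs : 0 < sin (β / 2) := sin_pos_of_pos_of_lt_pi (by linarith) (by linarith)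
  have h := radius_polar_pos hε (p * a)
  refine (pow_left_inj₀ (chordLength_pos hε (by simpa) (by simpa)).le (by positivity)
    two_ne_zero).1 ?_
  have hh : cos β = 1 - 2 * sin (β / 2) ^ 2 := by
    have := cos_two_mul (β / 2)
    rw [mul_div_cancel₀ _ two_ne_zero] at this
    rw [this, cos_sq']
    ring
  rw [chordLength_sq a a hε hβ, add_sub_cancel_right, hh]
  ring

variable {p : ℕ} [NeZero p]

/-- The angle of the `k`-th `p`-th root of unity. -/
def rootAngle (k : ZMod p) : ℝ := 2 * π * k.val / p

theorem mul_rootAngle (k : ZMod p) : p * rootAngle k = 2 * π * k.val := by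
  rw [rootAngle, mul_div_cancel₀]
  exact_mod_cast NeZero.ne p

theorem rootAngle_pos {k : ZMod p} (hk : k ≠ 0) : 0 < rootAngle k := by
  have : 0 < k.val := Nat.pos_of_ne_zero ((ZMod.val_ne_zero k).2 hk)
  have hp := Nat.pos_of_ne_zero (NeZero.ne p)
  unfold rootAngle
  positivity

theorem rootAngle_lt (k : ZMod p) : rootAngle k < 2 * π := by
  have hp : (0 : ℝ) < p := by exact_mod_cast Nat.pos_of_ne_zero (NeZero.ne p)
  have : (k.val : ℝ) < p := by exact_mod_cast ZMod.val_lt k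
  rw [rootAngle, div_lt_iff₀ hp]
  gcongr

/-- The perimeter of the polygon with vertices at the angles `i * rootAngle k + s i`. -/
def liftedPerimeter (k : ZMod p) (ε : ℝ) (s : ZMod p → ℝ) : ℝ :=
  ∑ i, chordLength p (rootAngle k) ε (s i) (s (i + 1))

theorem contDiffAt_uncurry_liftedPerimeter (k : ZMod p) {q : ℝ × (ZMod p → ℝ)} (hq : |q.1| < 1) :
    ContDiffAt ℝ ∞ (Function.uncurry (liftedPerimeter k)) q := by
  refine ContDiffAt.sum fun i _ => ?_
  exact ContDiffAt.comp (g := fun q : ℝ × ℝ × ℝ => chordLength p (rootAngle k) q.1 q.2.1 q.2.2)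
    (f := fun q : ℝ × (ZMod p → ℝ) => (q.1, q.2 i, q.2 (i + 1))) q
    (contDiffAt_chordLength p _ hq) (by fun_prop)

theorem contDiff_liftedPerimeter (k : ZMod p) {ε : ℝ} (hε : |ε| < 1) :
    ContDiff ℝ ∞ (liftedPerimeter k ε) :=
  contDiff_iff_contDiffAt.2 fun s =>
    ContDiffAt.comp (g := Function.uncurry (liftedPerimeter k)) (f := fun s => (ε, s)) s
      (contDiffAt_uncurry_liftedPerimeter k hε) (by fun_prop)

theorem contDiffAt_fderiv_liftedPerimeter (k : ZMod p) {q : ℝ × (ZMod p → ℝ)} (hq : |q.1| < 1) :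
    ContDiffAt ℝ ∞ (fun q : ℝ × (ZMod p → ℝ) => fderiv ℝ (liftedPerimeter k q.1) q.2) q := by
  refine ContDiffAt.fderiv (f := fun (q : ℝ × (ZMod p → ℝ)) s => liftedPerimeter k q.1 s)
    (n := ∞) ?_ contDiffAt_snd le_rfl
  exact ContDiffAt.comp (g := Function.uncurry (liftedPerimeter k))
    (f := fun q : (ℝ × (ZMod p → ℝ)) × (ZMod p → ℝ) => (q.1.1, q.2)) _
    (contDiffAt_uncurry_liftedPerimeter k hq) (by fun_prop)

theorem contDiffAt_fderiv_fderiv_liftedPerimeter (k : ZMod p) {q : ℝ × (ZMod p → ℝ)}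
    (hq : |q.1| < 1) : ContDiffAt ℝ ∞
      (fun q : ℝ × (ZMod p → ℝ) => fderiv ℝ (fderiv ℝ (liftedPerimeter k q.1)) q.2) q := by
  refine ContDiffAt.fderiv
    (f := fun (q : ℝ × (ZMod p → ℝ)) s => fderiv ℝ (liftedPerimeter k q.1) s)
    (n := ∞) ?_ contDiffAt_snd le_rfl
  exact ContDiffAt.comp
    (g := fun q : ℝ × (ZMod p → ℝ) => fderiv ℝ (liftedPerimeter k q.1) q.2)
    (f := fun q : (ℝ × (ZMod p → ℝ)) × (ZMod p → ℝ) => (q.1.1, q.2)) _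
    (contDiffAt_fderiv_liftedPerimeter k hq) (by fun_prop)

theorem liftedPerimeter_const {k : ZMod p} (hk : k ≠ 0) {ε : ℝ} (hε : |ε| < 1) (c : ℝ) :
    liftedPerimeter k ε (fun _ => c) = p * (2 * sin (rootAngle k / 2)) * (1 - ε * cos (p * c)) := by
  simp only [liftedPerimeter, chordLength_diag c hε (mul_rootAngle k) (rootAngle_pos hk)
    (rootAngle_lt k), Finset.sum_const, Finset.card_univ, ZMod.card, nsmul_eq_mul]
  ring

end

/-! ### Derivatives on the circle and at constant lifts. -/

section

open Real Polynomial.Chebyshev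
variable {p : ℕ}

/-- The difference of consecutive coordinates. -/
def coordDiff (i : ZMod p) : (ZMod p → ℝ) →L[ℝ] ℝ :=
  ContinuousLinearMap.proj (R := ℝ) (φ := fun _ => ℝ) (i + 1) -
    ContinuousLinearMap.proj (R := ℝ) (φ := fun _ => ℝ) i

@[simp]
theorem coordDiff_apply (i : ZMod p) (v : ZMod p → ℝ) : coordDiff i v = v (i + 1) - v i := rfl

variable [NeZero p]

theorem sum_shift (v : ZMod p → ℝ) (a : ZMod p) : ∑ i, v (i + a) = ∑ i, v i :=
  Fintype.sum_equiv (Equiv.addRight a) _ _ fun _ => rfl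

theorem hasFDerivAt_halfAngle (β : ℝ) (i : ZMod p) (s : ZMod p → ℝ) :
    HasFDerivAt (fun s : ZMod p → ℝ => (β + s (i + 1) - s i) / 2) ((2⁻¹ : ℝ) • coordDiff i) s := by
  have h : HasFDerivAt (fun s : ZMod p → ℝ => β / 2 + ((2⁻¹ : ℝ) • coordDiff i) s)
      ((2⁻¹ : ℝ) • coordDiff i) s := (ContinuousLinearMap.hasFDerivAt _).const_add _
  refine h.congr_of_eventuallyEq (Filter.Eventually.of_forall fun s => ?_)
  simp only [smul_apply, coordDiff_apply, smul_eq_mul]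
  ring

theorem fderiv_liftedPerimeter_zero (k : ZMod p) :
    fderiv ℝ (liftedPerimeter k 0) =
      fun s => ∑ i, cos ((rootAngle k + s (i + 1) - s i) / 2) • coordDiff i := by
  ext1 s
  refine HasFDerivAt.fderiv ?_
  have hF : liftedPerimeter k 0 =
      fun s => ∑ i, 2 * sin ((rootAngle k + s (i + 1) - s i) / 2) := by
    ext s
    simp only [liftedPerimeter, chordLength_zero]
  rw [hF]
  refine HasFDerivAt.fun_sum fun i _ => ?_
  have h := ((hasFDerivAt_halfAngle (rootAngle k) i s).sin).const_mul 2
  refine h.congr_fderiv ?_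
  ext v
  simp
  ring

theorem fderiv_fderiv_liftedPerimeter_zero (k : ZMod p) (s u v : ZMod p → ℝ) :
    fderiv ℝ (fderiv ℝ (liftedPerimeter k 0)) s u v =
      ∑ i, -(sin ((rootAngle k + s (i + 1) - s i) / 2) / 2) *
        ((u (i + 1) - u i) * (v (i + 1) - v i)) := by
  rw [fderiv_liftedPerimeter_zero]
  have h : HasFDerivAt (fun s : ZMod p → ℝ =>
      ∑ i, cos ((rootAngle k + s (i + 1) - s i) / 2) • coordDiff i) _ s :=
    HasFDerivAt.fun_sum fun i _ =>
      (hasFDerivAt_halfAngle (rootAngle k) i s).cos.smul_const (coordDiff i)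
  rw [h.fderiv]
  simp only [sum_apply]
  refine Finset.sum_congr rfl fun i _ => ?_
  simp
  ring

/-- Differences around a cycle sum to zero, which forces `a = 0`. -/
theorem eq_const_of_diff_const {s : ZMod p → ℝ} {a : ℝ} (h : ∀ i, s (i + 1) - s i = a) (i : ZMod p) :
    s i = s 0 := by
  have h0 : ∑ i, (s (i + 1) - s i) = 0 := by
    rw [Finset.sum_sub_distrib, sum_shift, sub_self]
  have ha : a = 0 := by
    simpa [h, NeZero.ne p] using h0
  have hn : ∀ n : ℕ, s n = s 0 := fun n => by
    induction n with
    | zero => simp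
    | succ n ih => rw [← ih, Nat.cast_add_one]; linarith [h n]
  simpa using hn i.val

/-- Summation by parts shows that the cosines of all half-angles agree. The half-angles lie in `[0,
π]`, where the cosine is injective, endpoints included; so degenerate lifts are covered too. -/
theorem eq_const_of_fderiv_liftedPerimeter_zero {k : ZMod p} {s : ZMod p → ℝ}
    (hs : ∀ i, rootAngle k + s (i + 1) - s i ∈ Set.Icc 0 (2 * π))
    (h : fderiv ℝ (liftedPerimeter k 0) s = 0) (i : ZMod p) : s i = s 0 := by
  set C : ZMod p → ℝ := fun i => cos ((rootAngle k + s (i + 1) - s i) / 2) with hC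
  have h1 : ∀ v : ZMod p → ℝ, ∑ i, (C i - C (i + 1)) * v (i + 1) = 0 := by
    intro v
    have h2 : ∑ i, C i * (v (i + 1) - v i) = 0 := by
      simpa [fderiv_liftedPerimeter_zero] using congrArg (fun L => L v) h
    have h3 := sum_shift (fun i => C i * v i) 1
    simp only [mul_sub, sub_mul, Finset.sum_sub_distrib] at h2 ⊢
    linarith
  have h4 : ∀ i, C i = C (i + 1) := by
    -- This test vector turns the sum into a sum of squares.
    have := h1 fun i => C (i - 1) - C i
    simp only [add_sub_cancel_right] at this
    rw [Finset.sum_eq_zero_iff_of_nonneg fun i _ => mul_self_nonneg _] at this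
    exact fun i => sub_eq_zero.1 (mul_self_eq_zero.1 (this i (Finset.mem_univ i)))
  refine eq_const_of_diff_const (a := s 1 - s 0) (fun j => ?_) i
  have h5 : ∀ n : ℕ, C n = C 0 := fun n => by
    induction n with
    | zero => simp
    | succ n ih => rw [← ih, Nat.cast_add_one, ← h4]
  have h6 : C j = C 0 := by simpa using h5 j.val
  have hm : ∀ i, (rootAngle k + s (i + 1) - s i) / 2 ∈ Set.Icc 0 π := fun i =>
    ⟨by linarith [(hs i).1], by linarith [(hs i).2]⟩
  have : (rootAngle k + s (j + 1) - s j) / 2 = (rootAngle k + s (0 + 1) - s 0) / 2 :=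
    injOn_cos (hm j) (hm 0) h6
  rw [zero_add] at this
  linarith

/-- The form is a negative multiple of the sum of squared consecutive differences. Its kernel is the
line of constants, which meets the sum-zero hyperplane only in `0`. -/
theorem fderiv_fderiv_liftedPerimeter_zero_neg {k : ZMod p} (hk : k ≠ 0) (c : ℝ)
    {v : ZMod p → ℝ} (hv : v ≠ 0) (hsum : ∑ i, v i = 0) :
    fderiv ℝ (fderiv ℝ (liftedPerimeter k 0)) (fun _ => c) v v < 0 := by
  have hs : 0 < sin (rootAngle k / 2) :=
    sin_pos_of_pos_of_lt_pi (by linarith [rootAngle_pos hk]) (by linarith [rootAngle_lt k])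
  rw [fderiv_fderiv_liftedPerimeter_zero, ← Finset.mul_sum, add_sub_cancel_right]
  refine mul_neg_of_neg_of_pos (by linarith) ?_
  refine lt_of_le_of_ne (Finset.sum_nonneg fun i _ => mul_self_nonneg _) fun h => hv ?_
  rw [eq_comm, Finset.sum_eq_zero_iff_of_nonneg fun i _ => mul_self_nonneg _] at h
  have h1 := eq_const_of_diff_const (s := v) (a := 0)
    fun i => mul_self_eq_zero.1 (h i (Finset.mem_univ i))
  rw [Fintype.sum_congr _ _ h1] at hsum
  have h2 : v 0 = 0 := by simpa [NeZero.ne p] using hsum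
  ext i
  rw [h1, h2, Pi.zero_apply]

theorem liftedPerimeter_rotate (k : ZMod p) (ε : ℝ) (s : ZMod p → ℝ) (a : ZMod p) :
    liftedPerimeter k ε (fun i => s (i + a)) = liftedPerimeter k ε s := by
  refine Fintype.sum_equiv (Equiv.addRight a) _ _ fun i => ?_
  simp only [Equiv.coe_addRight]
  rw [add_right_comm]

/-- A constant lift is fixed by cyclic shifts, so the differential there is shift invariant and
hence a multiple of the coordinate sum. The explicit perimeter along the line of constants fixes the
factor. -/
theorem fderiv_liftedPerimeter_const {k : ZMod p} (hk : k ≠ 0) {ε : ℝ} (hε : |ε| < 1) (c : ℝ)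
    (v : ZMod p → ℝ) : fderiv ℝ (liftedPerimeter k ε) (fun _ => c) v =
      2 * sin (rootAngle k / 2) * ε * p * sin (p * c) * ∑ i, v i := by
  have hd := (contDiff_liftedPerimeter k hε).differentiable (by simp)
  set D := fderiv ℝ (liftedPerimeter k ε) (fun _ => c) with hD
  have h1 : ∀ a : ZMod p, D (fun i => v (i + a)) = D v := by
    intro a
    let S : (ZMod p → ℝ) →L[ℝ] (ZMod p → ℝ) :=
      ContinuousLinearMap.pi fun i => ContinuousLinearMap.proj (i + a)
    have hS : liftedPerimeter k ε ∘ S = liftedPerimeter k ε :=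
      funext fun s => liftedPerimeter_rotate k ε s a
    have := fderiv_comp (𝕜 := ℝ) (fun _ => c) (hd (S fun _ => c)) S.differentiableAt
    rw [hS, S.fderiv] at this
    exact (congrArg (fun L => L v) this).symm
  have h2 : p * D v = D fun _ => ∑ i, v i := by
    have : (fun _ => ∑ i, v i : ZMod p → ℝ) = ∑ a, fun i => v (i + a) := by
      ext i
      rw [Finset.sum_apply]
      simp only [add_comm i]
      exact (sum_shift v i).symm
    rw [this, map_sum]
    simp [h1]
  have h3 : (fun _ => ∑ i, v i : ZMod p → ℝ) = (∑ i, v i) • fun _ => (1 : ℝ) := by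
    ext; simp
  have h4 : HasDerivAt (fun x : ℝ => liftedPerimeter k ε fun _ => x) (D fun _ => 1) c := by
    have hc : HasDerivAt (fun x : ℝ => (fun _ => x : ZMod p → ℝ)) (fun _ => 1) c :=
      hasDerivAt_pi.2 fun _ => hasDerivAt_id c
    exact HasFDerivAt.comp_hasDerivAt (l := liftedPerimeter k ε)
      (f := fun x : ℝ => (fun _ => x : ZMod p → ℝ)) c (hd fun _ => c).hasFDerivAt hc
  have h5 : HasDerivAt (fun x : ℝ => liftedPerimeter k ε fun _ => x)
      (p * (2 * sin (rootAngle k / 2)) * (ε * (p * sin (p * c)))) c := by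
    simp only [liftedPerimeter_const hk hε]
    have := (((hasDerivAt_id c).const_mul (p : ℝ)).cos.const_mul ε).const_sub 1 |>.const_mul
      (p * (2 * sin (rootAngle k / 2)))
    refine this.congr_deriv ?_
    simp only [id]
    ring
  rw [h3, map_smul, h4.unique h5, smul_eq_mul] at h2
  have hp : (p : ℝ) ≠ 0 := by exact_mod_cast NeZero.ne p
  apply mul_left_cancel₀ hp
  rw [h2]
  ring

/-- Differentiating the formula for the differential along the line of constants suffices, since one
argument of the Hessian is tangent to that line. -/
theorem fderiv_fderiv_liftedPerimeter_const {k : ZMod p} (hk : k ≠ 0) {ε : ℝ} (hε : |ε| < 1) (c : ℝ)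
    (v : ZMod p → ℝ) : fderiv ℝ (fderiv ℝ (liftedPerimeter k ε)) (fun _ => c) (fun _ => 1) v =
      2 * sin (rootAngle k / 2) * ε * p ^ 2 * cos (p * c) * ∑ i, v i := by
  have hd : Differentiable ℝ (fderiv ℝ (liftedPerimeter k ε)) :=
    ((contDiff_liftedPerimeter k hε).fderiv_right (m := ∞) le_rfl).differentiable (by simp)
  have hc : HasDerivAt (fun x : ℝ => (fun _ => x : ZMod p → ℝ)) (fun _ => 1) c :=
    hasDerivAt_pi.2 fun _ => hasDerivAt_id c
  have h0 := HasFDerivAt.comp_hasDerivAt (l := fderiv ℝ (liftedPerimeter k ε))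
      (f := fun x : ℝ => (fun _ => x : ZMod p → ℝ)) c (hd fun _ => c).hasFDerivAt hc
  have h1 := h0.clm_apply (hasDerivAt_const c v)
  have h2 : HasDerivAt (fun x : ℝ => fderiv ℝ (liftedPerimeter k ε) (fun _ => x) v)
      (2 * sin (rootAngle k / 2) * ε * p * (p * cos (p * c)) * ∑ i, v i) c := by
    simp only [fderiv_liftedPerimeter_const hk hε]
    have := (((hasDerivAt_id c).const_mul (p : ℝ)).sin.const_mul
      (2 * sin (rootAngle k / 2) * ε * p)).mul_const (∑ i, v i)
    refine this.congr_deriv ?_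
    simp only [id]
    ring
  have h3 := h1.unique h2
  simp only [Function.comp_apply, map_zero, add_zero] at h3
  rw [h3]
  ring

theorem fderiv_fderiv_liftedPerimeter_symm (k : ZMod p) {ε : ℝ} (hε : |ε| < 1)
    (s u v : ZMod p → ℝ) : fderiv ℝ (fderiv ℝ (liftedPerimeter k ε)) s u v =
      fderiv ℝ (fderiv ℝ (liftedPerimeter k ε)) s v u :=
  ((contDiff_liftedPerimeter k hε).contDiffAt.isSymmSndFDerivAt (by
    simpa using ENat.LEInfty.out)).eq u v

end

/-! ### Compactness and perturbation from the circle. -/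

section

open Real Polynomial.Chebyshev Filter Topology
variable {p : ℕ} [NeZero p]

/-- The lifts of polygons with first vertex in a fundamental interval, including degenerate ones. -/
def liftDomain (k : ZMod p) : Set (ZMod p → ℝ) :=
  {s | s 0 ∈ Set.Icc 0 (2 * π) ∧ ∀ i, rootAngle k + s (i + 1) - s i ∈ Set.Icc 0 (2 * π)}

theorem isCompact_liftDomain (k : ZMod p) : IsCompact (liftDomain k) := by
  have hcl : IsClosed (liftDomain k) := by
    simp only [liftDomain, Set.ofPred_and, Set.ofPred_forall]
    refine (isClosed_Icc.preimage (by fun_prop)).inter (isClosed_iInter fun i => ?_)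
    exact isClosed_Icc.preimage (f := fun s : ZMod p → ℝ => rootAngle k + s (i + 1) - s i)
      (by fun_prop)
  have hk0 : 0 ≤ rootAngle k := by unfold rootAngle; positivity
  have hk1 := rootAngle_lt k
  refine (isCompact_univ_pi fun i : ZMod p =>
    isCompact_Icc (a := -(2 * π * (i.val + 1))) (b := 2 * π * (i.val + 1))).of_isClosed_subset hcl ?_
  intro s hs i _
  -- Both `rootAngle k` and the angle differences lie in `[0, 2π]`, so one step changes `s` by at
  -- most `2π`.
  have hn : ∀ n : ℕ, s n ∈ Set.Icc (-(2 * π * (n + 1))) (2 * π * (n + 1)) := fun n => by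
    induction n with
    | zero =>
      have h0 := hs.1
      simp only [Nat.cast_zero, zero_add, mul_one]
      exact ⟨by linarith [h0.1, pi_pos], h0.2⟩
    | succ n ih =>
      have h0 := hs.2 n
      rw [Nat.cast_add_one]
      push_cast
      exact ⟨by linarith [h0.1, ih.1], by linarith [h0.2, ih.2]⟩
  simpa using hn i.val

/-- The average of the coordinates. -/
def average (s : ZMod p → ℝ) : ℝ := (∑ i, s i) / p

theorem continuous_average : Continuous (average : (ZMod p → ℝ) → ℝ) := by
  unfold average; fun_prop

theorem sum_sub_average (s : ZMod p → ℝ) : ∑ i, (s i - average s) = 0 := by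
  have hp : (p : ℝ) ≠ 0 := by exact_mod_cast NeZero.ne p
  simp [average, mul_div_cancel₀ _ hp]

/-- Negativity at `ε = 0` persists uniformly over the compact product of `C` with the unit sphere of
the sum-zero hyperplane; homogeneity then gives all nonzero `v`. -/
theorem eventually_hessian_neg {k : ZMod p} (hk : k ≠ 0) {C : Set ℝ} (hC : IsCompact C) :
    ∀ᶠ q : ℝ × (ZMod p → ℝ) in 𝓝 0, ∀ c ∈ C, ∀ v : ZMod p → ℝ, v ≠ 0 → ∑ i, v i = 0 →
      fderiv ℝ (fderiv ℝ (liftedPerimeter k q.1)) ((fun _ => c) + q.2) v v < 0 := by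
  have hS : IsCompact {v : ZMod p → ℝ | v ∈ Metric.sphere 0 1 ∧ ∑ i, v i = 0} :=
    (isCompact_sphere _ _).inter_right (isClosed_singleton.preimage (by fun_prop))
  have key : ∀ᶠ q : ℝ × (ZMod p → ℝ) in 𝓝 0, ∀ y ∈ C ×ˢ {v : ZMod p → ℝ |
      v ∈ Metric.sphere 0 1 ∧ ∑ i, v i = 0},
      fderiv ℝ (fderiv ℝ (liftedPerimeter k q.1)) ((fun _ => y.1) + q.2) y.2 y.2 < 0 := by
    refine (hC.prod hS).eventually_forall_of_forall_eventually fun y hy => ?_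
    have hcont : ContinuousAt (fun z : (ℝ × (ZMod p → ℝ)) × ℝ × (ZMod p → ℝ) =>
        fderiv ℝ (fderiv ℝ (liftedPerimeter k z.1.1)) ((fun _ => z.2.1) + z.1.2) z.2.2 z.2.2)
        (0, y) := by
      have h1 : ContinuousAt (fun z : (ℝ × (ZMod p → ℝ)) × ℝ × (ZMod p → ℝ) =>
          fderiv ℝ (fderiv ℝ (liftedPerimeter k z.1.1)) ((fun _ => z.2.1) + z.1.2)) (0, y) :=
        ContinuousAt.comp
          (g := fun q : ℝ × (ZMod p → ℝ) => fderiv ℝ (fderiv ℝ (liftedPerimeter k q.1)) q.2)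
          (f := fun z : (ℝ × (ZMod p → ℝ)) × ℝ × (ZMod p → ℝ) =>
            (z.1.1, (fun _ => z.2.1) + z.1.2))
          (contDiffAt_fderiv_fderiv_liftedPerimeter k (by simp)).continuousAt (by fun_prop)
      exact (h1.clm_apply (by fun_prop)).clm_apply (by fun_prop)
    refine hcont.eventually_lt_const ?_
    simpa using fderiv_fderiv_liftedPerimeter_zero_neg hk y.1
      (Metric.ne_of_mem_sphere hy.2.1 one_ne_zero) hy.2.2
  filter_upwards [key] with q hq c hc v hv hsum
  have hn : 0 < ‖v‖ := norm_pos_iff.2 hv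
  have h := hq (c, ‖v‖⁻¹ • v) ⟨hc, by simp [norm_smul, hn.ne'], by
    simp [← Finset.mul_sum, hsum]⟩
  simp only [map_smul, smul_apply, smul_eq_mul] at h
  have h2 : 0 < ‖v‖⁻¹ := inv_pos.2 hn
  exact (pos_iff_neg_of_mul_neg (a := ‖v‖⁻¹) (by nlinarith)).1 h2

/-- On the compact set of lifts at distance at least `δ` from their average, the differential is
nonzero at `ε = 0`, hence also for all small `ε`. -/
theorem eventually_near_const_of_fderiv_eq_zero {k : ZMod p} {δ : ℝ} (hδ : 0 < δ) :
    ∀ᶠ ε in 𝓝 (0 : ℝ), ∀ s ∈ liftDomain k, fderiv ℝ (liftedPerimeter k ε) s = 0 →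
      ‖s - fun _ => average s‖ < δ := by
  have hK : IsCompact (liftDomain k ∩ {s | δ ≤ ‖s - fun _ => average s‖}) := by
    have := continuous_average (p := p)
    exact (isCompact_liftDomain k).inter_right 
      (isClosed_le continuous_const (by fun_prop))
  have key : ∀ᶠ ε in 𝓝 (0 : ℝ), ∀ s ∈ liftDomain k ∩ {s | δ ≤ ‖s - fun _ => average s‖},
      fderiv ℝ (liftedPerimeter k ε) s ≠ 0 := by
    refine hK.eventually_forall_of_forall_eventually fun s hs => ?_
    refine (contDiffAt_fderiv_liftedPerimeter k (q := (0, s)) (by simp)).continuousAt.eventually_ne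
      fun h0 => ?_
    have h1 := eq_const_of_fderiv_liftedPerimeter_zero hs.1.2 h0
    have h2 : s - (fun _ => average s) = 0 := by
      ext i
      have hp : (p : ℝ) ≠ 0 := by exact_mod_cast NeZero.ne p
      simp [average, Fintype.sum_congr _ _ h1, h1 i, hp]
    have h3 := hs.2
    simp only [Set.mem_ofPred_eq, h2, norm_zero] at h3
    linarith
  filter_upwards [key] with ε hε s hs h0
  by_contra hn
  exact hε s ⟨hs, not_lt.1 hn⟩ h0

/-- For small `ε` every critical lift is a regular polygon, and the Hessian at a regular polygon is
negative definite transversally to the rotations. -/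
theorem eventually_critical_const {k : ZMod p} (hk : k ≠ 0) :
    ∀ᶠ ε in 𝓝 (0 : ℝ), (∀ s ∈ liftDomain k, fderiv ℝ (liftedPerimeter k ε) s = 0 →
        ∀ i, s i = s 0) ∧
      ∀ c ∈ Set.Icc 0 (2 * π), ∀ v : ZMod p → ℝ, v ≠ 0 → ∑ i, v i = 0 →
        fderiv ℝ (fderiv ℝ (liftedPerimeter k ε)) (fun _ => c) v v < 0 := by
  -- Averages of lifts serve as base points for Rolle's theorem; the interval `[0, 2π]` serves the
  -- second claim.
  have hA := (isCompact_liftDomain k).image continuous_average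
  obtain ⟨δ, hδ, h1⟩ := Metric.eventually_nhds_iff.1
    (eventually_hessian_neg hk (hA.union (isCompact_Icc (a := 0) (b := 2 * π))))
  have hsmall : ∀ᶠ ε in 𝓝 (0 : ℝ), |ε| < 1 ∧ |ε| < δ :=
    (continuous_abs.tendsto' (0 : ℝ) 0 abs_zero).eventually_lt_const one_pos |>.and
      ((continuous_abs.tendsto' (0 : ℝ) 0 abs_zero).eventually_lt_const hδ)
  filter_upwards [hsmall, eventually_near_const_of_fderiv_eq_zero (k := k) hδ] with ε ⟨hε1, hεδ⟩ h2
  have h3 : ∀ c ∈ average '' liftDomain k ∪ Set.Icc 0 (2 * π), ∀ w : ZMod p → ℝ, ‖w‖ < δ →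
      ∀ v : ZMod p → ℝ, v ≠ 0 → ∑ i, v i = 0 →
      fderiv ℝ (fderiv ℝ (liftedPerimeter k ε)) ((fun _ => c) + w) v v < 0 := by
    intro c hc w hw
    refine h1 (y := (ε, w)) ?_ c hc
    rw [dist_zero_right, Prod.norm_mk]
    exact max_lt hεδ hw
  refine ⟨fun s hs h0 => ?_, fun c hc v hv hsum => ?_⟩
  · by_contra hne
    set a := average s with ha
    set w : ZMod p → ℝ := s - fun _ => a with hw
    have hwsum : ∑ i, w i = 0 := by simpa [hw] using sum_sub_average s
    have hwne : w ≠ 0 := fun h => hne fun i => by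
      have h4 := fun i => sub_eq_zero.1 (congrFun h i)
      rw [h4 i, h4 0]
    have hwδ : ‖w‖ < δ := h2 s hs h0
    have hd : Differentiable ℝ (fderiv ℝ (liftedPerimeter k ε)) :=
      ((contDiff_liftedPerimeter k hε1).fderiv_right (m := ∞) le_rfl).differentiable (by simp)
    have hder : ∀ t : ℝ, HasDerivAt
        (fun t : ℝ => fderiv ℝ (liftedPerimeter k ε) ((fun _ => a) + t • w) w)
        (fderiv ℝ (fderiv ℝ (liftedPerimeter k ε)) ((fun _ => a) + t • w) w w) t := by
      intro t
      have hl : HasDerivAt (fun t : ℝ => (fun _ => a : ZMod p → ℝ) + t • w) w t := by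
        simpa using ((hasDerivAt_id t).smul_const w).const_add (fun _ => a : ZMod p → ℝ)
      have h5 := HasFDerivAt.comp_hasDerivAt (l := fderiv ℝ (liftedPerimeter k ε))
        (f := fun t : ℝ => (fun _ => a : ZMod p → ℝ) + t • w) t (hd _).hasFDerivAt hl
      simpa using h5.clm_apply (hasDerivAt_const t w)
    -- The derivative in direction `w` vanishes at both ends of the segment: at the average because
    -- `w` has sum zero, and at `s` because `s` is critical.
    obtain ⟨t, ht, h6⟩ := exists_hasDerivAt_eq_zero (zero_lt_one' ℝ)
      (fun t _ => (hder t).continuousAt.continuousWithinAt) (by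
        simp only [zero_smul, add_zero, one_smul]
        rw [fderiv_liftedPerimeter_const hk hε1, hwsum, hw, add_sub_cancel, h0]
        simp) fun t _ => hder t
    refine (h3 a (Or.inl ⟨s, hs, rfl⟩) (t • w) ?_ w hwne hwsum).ne h6
    rw [norm_smul, Real.norm_of_nonneg ht.1.le]
    nlinarith [norm_nonneg w, ht.2]
  · simpa using h3 c (Or.inr hc) 0 (by simpa) v hv hsum

end

/-! ### Polygons as lifts with a winding number. -/

section

open Real Filter Topology
variable {p : ℕ} [NeZero p]

/-- The polygon with vertices at the angles `i * rootAngle k + s i`. -/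
def starPolygon (k : ZMod p) (s : ZMod p → ℝ) : Polygon p :=
  fun i => ZMod.toCircle (k * i) * Circle.exp (s i)

theorem toCircle_eq_exp_rootAngle (k : ZMod p) : ZMod.toCircle k = Circle.exp (rootAngle k) := by
  rw [ZMod.toCircle_eq_circleExp, rootAngle]
  congr 1
  ring

theorem toCircle_pow_card (j : ZMod p) : ZMod.toCircle j ^ p = 1 := by
  rw [← AddChar.map_nsmul_eq_pow]
  simp

theorem starPolygon_pow (k : ZMod p) (s : ZMod p → ℝ) (i : ZMod p) :
    starPolygon k s i ^ p = Circle.exp (p * s i) := by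
  rw [starPolygon, mul_pow, toCircle_pow_card, one_mul, ← nsmul_eq_mul, Circle.exp_nsmul]

theorem radius_starPolygon (ε : ℝ) (k : ZMod p) (s : ZMod p → ℝ) (i : ZMod p) :
    radius p ε (starPolygon k s i) = 1 - ε * cos (p * s i) := by
  rw [radius, ← Circle.coe_pow, starPolygon_pow, Circle.coe_exp]
  norm_cast
  rw [Complex.exp_ofReal_mul_I_re]

theorem starPolygon_succ (k : ZMod p) (s : ZMod p → ℝ) (i : ZMod p) :
    starPolygon k s (i + 1) = starPolygon k s i * Circle.exp (rootAngle k + s (i + 1) - s i) := by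
  rw [starPolygon, starPolygon, mul_add, mul_one, AddChar.map_add_eq_mul,
    toCircle_eq_exp_rootAngle k, mul_assoc, mul_assoc, ← Circle.exp_add, ← Circle.exp_add]
  congr 2
  ring

/-- Both squares are given by the law of cosines, after rotating the first vertex to the positive
real axis. -/
theorem dist_deformedCircle_starPolygon {ε : ℝ} (hε : |ε| < 1) (k : ZMod p) (s : ZMod p → ℝ)
    (i : ZMod p) : dist (deformedCircle p ε (starPolygon k s i))
      (deformedCircle p ε (starPolygon k s (i + 1))) =
        |chordLength p (rootAngle k) ε (s i) (s (i + 1))| := by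
  rw [← abs_of_nonneg (dist_nonneg (x := deformedCircle p ε (starPolygon k s i))),
    ← sq_eq_sq_iff_abs_eq_abs, chordLength_sq _ _ hε (mul_rootAngle k), deformedCircle_eq, deformedCircle_eq, dist_eq_norm,
    ← map_sub, norm_planeOfComplex, radius_starPolygon, radius_starPolygon, starPolygon_succ]
  set r := 1 - ε * cos (p * s i)
  set r' := 1 - ε * cos (p * s (i + 1))
  set t := rootAngle k + s (i + 1) - s i
  have h : (r : ℂ) * (starPolygon k s i : ℂ) - r' * ((starPolygon k s i * Circle.exp t : Circle) : ℂ)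
      = starPolygon k s i * ((r - r' * cos t : ℝ) + (-(r' * sin t) : ℝ) * Complex.I) := by
    rw [Circle.coe_mul, Circle.coe_exp, Complex.exp_mul_I]
    push_cast
    ring
  rw [h, norm_mul, Circle.norm_coe, one_mul, ← Complex.normSq_eq_norm_sq, Complex.normSq_add_mul_I]
  linear_combination r' ^ 2 * sin_sq_add_cos_sq t

/-- The parameters for which consecutive vertices of `starPolygon k` are separated by an angle
between `0` and `2 π`. -/
def liftInterior (k : ZMod p) : Set (ZMod p → ℝ) :=
  {s | ∀ i, rootAngle k + s (i + 1) - s i ∈ Set.Ioo 0 (2 * π)}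

theorem isOpen_liftInterior (k : ZMod p) : IsOpen (liftInterior k) := by
  simp only [liftInterior, Set.ofPred_forall]
  exact isOpen_iInter_of_finite fun i =>
    isOpen_Ioo.preimage (f := fun s : ZMod p → ℝ => rootAngle k + s (i + 1) - s i) (by fun_prop)

theorem const_mem_liftInterior {k : ZMod p} (hk : k ≠ 0) (c : ℝ) :
    (fun _ => c) ∈ liftInterior k := fun i => by
  simpa using ⟨rootAngle_pos hk, rootAngle_lt k⟩

theorem perimeter_starPolygon {ε : ℝ} (hε : |ε| < 1) {k : ZMod p} {s : ZMod p → ℝ}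
    (hs : s ∈ liftInterior k) :
    perimeter (deformedCircle p ε) (starPolygon k s) = liftedPerimeter k ε s := by
  refine Finset.sum_congr rfl fun i _ => ?_
  rw [dist_deformedCircle_starPolygon hε, abs_of_pos (chordLength_pos hε (hs i).1 (hs i).2)]

theorem starPolygon_add (k : ZMod p) (s t : ZMod p → ℝ) :
    (fun i => starPolygon k s i * Circle.exp (t i)) = starPolygon k (s + t) := by
  ext1 i
  rw [starPolygon, starPolygon, Pi.add_apply, Circle.exp_add, mul_assoc]

theorem localPerimeter_starPolygon {ε : ℝ} (hε : |ε| < 1) {k : ZMod p} {s : ZMod p → ℝ}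
    (hs : s ∈ liftInterior k) : localPerimeter (deformedCircle p ε) (starPolygon k s) =ᶠ[𝓝 0]
      fun t => liftedPerimeter k ε (s + t) := by
  have h : ∀ᶠ t in 𝓝 (0 : ZMod p → ℝ), s + t ∈ liftInterior k :=
    (continuous_const_add s).continuousAt.eventually_mem
      ((isOpen_liftInterior k).mem_nhds (by simpa using hs))
  filter_upwards [h] with t ht
  rw [localPerimeter, starPolygon_add, perimeter_starPolygon hε ht]

theorem starPolygon_notMem_diagonal {k : ZMod p} {s : ZMod p → ℝ} (hs : s ∈ liftInterior k) :
    starPolygon k s ∉ diagonal p := by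
  rintro ⟨i, hi⟩
  rw [starPolygon_succ, left_eq_mul, Circle.exp_eq_one] at hi
  obtain ⟨n, hn⟩ := hi
  have h := hs i
  rw [hn] at h
  have h0 : (0 : ℝ) < n := pos_of_mul_pos_left h.1 two_pi_pos.le
  have h1 : (n : ℝ) < 1 := lt_of_mul_lt_mul_right (by linarith [h.2]) two_pi_pos.le
  have h0' : 0 < n := by exact_mod_cast h0
  have h1' : n < 1 := by exact_mod_cast h1
  omega

theorem isCriticalPolygon_starPolygon_iff {ε : ℝ} (hε : |ε| < 1) {k : ZMod p} {s : ZMod p → ℝ}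
    (hs : s ∈ liftInterior k) :
    IsCriticalPolygon (deformedCircle p ε) (starPolygon k s) ↔
      fderiv ℝ (liftedPerimeter k ε) s = 0 := by
  rw [IsCriticalPolygon, (localPerimeter_starPolygon hε hs).hasFDerivAt_iff]
  have hd := (contDiff_liftedPerimeter k hε).differentiable (by simp) s
  constructor
  · rintro ⟨-, h⟩
    have := h.fderiv
    rwa [fderiv_comp_add_left, add_zero] at this
  · intro h
    refine ⟨starPolygon_notMem_diagonal hs, ?_⟩
    rw [hasFDerivAt_comp_add_left, add_zero, ← h]
    exact hd.hasFDerivAt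

theorem hessian_starPolygon {ε : ℝ} (hε : |ε| < 1) {k : ZMod p} {s : ZMod p → ℝ}
    (hs : s ∈ liftInterior k) : hessian (deformedCircle p ε) (starPolygon k s) =
      fderiv ℝ (fderiv ℝ (liftedPerimeter k ε)) s := by
  rw [hessian, (localPerimeter_starPolygon hε hs).fderiv.fderiv_eq]
  have : fderiv ℝ (fun t => liftedPerimeter k ε (s + t)) =
      fun t => fderiv ℝ (liftedPerimeter k ε) (s + t) :=
    funext fun t => fderiv_comp_add_left s
  rw [this, fderiv_comp_add_left, add_zero]

/-- Partial sums solve the difference equation; the zero total is what closes the cycle at the last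
index. -/
theorem exists_diff_eq {g : ZMod p → ℝ} (hg : ∑ i, g i = 0) (c : ℝ) :
    ∃ s : ZMod p → ℝ, s 0 = c ∧ ∀ i, s (i + 1) - s i = g i := by
  refine ⟨fun i => c + ∑ j ∈ Finset.range i.val, g j, by simp, fun i => ?_⟩
  have hsum : ∑ j ∈ Finset.range p, g j = 0 := by
    rw [← hg]
    refine Finset.sum_bij' (fun j _ => (j : ZMod p)) (fun i _ => i.val) ?_ ?_ ?_ ?_ ?_
    · simp
    · simp [ZMod.val_lt]
    · intro j hj
      exact ZMod.val_natCast_of_lt (Finset.mem_range.1 hj)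
    · simp
    · simp
  have key : ∑ j ∈ Finset.range (i + 1).val, g j = ∑ j ∈ Finset.range (i.val + 1), g j := by
    rcases lt_or_ge (i.val + 1) p with h | h
    · rw [← ZMod.val_natCast_of_lt h]
      simp
    · have h1 : i.val + 1 = p := le_antisymm (ZMod.val_lt i) h
      have h2 : i + 1 = 0 := by
        have : ((i.val + 1 : ℕ) : ZMod p) = 0 := by rw [h1]; simp
        simpa using this
      rw [h1, h2, hsum]
      simp
  simp only [key, Finset.sum_range_succ]
  simp

/-- The winding number supplies `k`, and integrating the deviations of the angle differences from
`rootAngle k` supplies `s`. -/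
theorem exists_starPolygon_eq {x : Polygon p} (hx : x ∉ diagonal p) :
    ∃ k : ZMod p, k ≠ 0 ∧ ∃ s ∈ liftDomain k, s ∈ liftInterior k ∧ starPolygon k s = x := by
  set d : ZMod p → ℝ := fun i => Circle.angleDiff (x i) (x (i + 1)) with hd
  have hd0 : ∀ i, 0 < d i := fun i => Circle.angleDiff_pos fun h => hx ⟨i, h⟩
  have hd1 : ∀ i, d i < 2 * π := fun i => Circle.angleDiff_lt_two_pi _ _
  have hdx : ∀ i, x (i + 1) = x i * Circle.exp (d i) := fun i => by
    rw [mul_comm]; exact Circle.exp_angleDiff_mul.symm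
  have hp0 : (0 : ℝ) < p := by exact_mod_cast Nat.pos_of_ne_zero (NeZero.ne p)
  -- The product of the quotients of consecutive vertices around the cycle is `1`.
  obtain ⟨n, hn⟩ : ∃ n : ℤ, ∑ i, d i = n * (2 * π) := by
    have h1 : ∏ i, x (i + 1) = ∏ i, x i := Equiv.prod_comp (Equiv.addRight 1) x
    have h2 : ∀ t : Finset (ZMod p), Circle.exp (∑ i ∈ t, d i) = ∏ i ∈ t, Circle.exp (d i) :=
      fun t => by
        induction t using Finset.cons_induction with
        | empty => simp
        | cons a t ha ih => rw [Finset.sum_cons, Finset.prod_cons, Circle.exp_add, ih]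
    rw [← Circle.exp_eq_one, h2]
    simpa [hdx, Finset.prod_mul_distrib] using h1
  have hn0 : 0 < n := by
    have h : 0 < ∑ i, d i := Finset.sum_pos (fun i _ => hd0 i) Finset.univ_nonempty
    rw [hn] at h
    exact_mod_cast pos_of_mul_pos_left h two_pi_pos.le
  have hn1 : n < p := by
    have h : ∑ i, d i < ∑ _i : ZMod p, 2 * π :=
      Finset.sum_lt_sum_of_nonempty Finset.univ_nonempty fun i _ => hd1 i
    rw [hn, Finset.sum_const, Finset.card_univ, ZMod.card, nsmul_eq_mul] at h
    exact_mod_cast lt_of_mul_lt_mul_right h two_pi_pos.le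
  obtain ⟨m, rfl⟩ := Int.eq_ofNat_of_zero_le hn0.le
  have hm : ((m : ZMod p)).val = m := ZMod.val_natCast_of_lt (by exact_mod_cast hn1)
  have hmr : p * rootAngle (m : ZMod p) = ∑ i, d i := by
    rw [mul_rootAngle, hm, hn]
    push_cast
    ring
  have hm0 : (m : ZMod p) ≠ 0 := by
    rw [← ZMod.val_ne_zero, hm]
    omega
  set k : ZMod p := (m : ZMod p)
  obtain ⟨s, hs0, hs⟩ := exists_diff_eq (g := fun i => d i - rootAngle k)
    (by simp [← hmr]) (Circle.angleDiff 1 (x 0))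
  have hsd : ∀ i, rootAngle k + s (i + 1) - s i = d i := fun i => by linarith [hs i]
  refine ⟨k, hm0, s, ⟨?_, fun i => ?_⟩, fun i => ?_, ?_⟩
  · rw [hs0]
    exact ⟨Circle.angleDiff_nonneg _ _, (Circle.angleDiff_lt_two_pi _ _).le⟩
  · rw [hsd]
    exact ⟨(hd0 i).le, (hd1 i).le⟩
  · rw [hsd]
    exact ⟨hd0 i, hd1 i⟩
  · have hnat : ∀ j : ℕ, starPolygon k s j = x j := fun j => by
      induction j with
      | zero =>
        have := Circle.exp_angleDiff_mul (x := 1) (y := x 0)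
        simpa [starPolygon, hs0] using this
      | succ j ih => rw [Nat.cast_add_one, starPolygon_succ, hsd, ih, hdx]
    ext1 i
    simpa using hnat i.val

end

/-! ### Second derivative test, index of forms, local maxima in charts. -/

section

open Real Filter Topology

/-- The second derivative test. -/
theorem isLocalMax_of_fderiv_fderiv_neg {V : Type*} [NormedAddCommGroup V] [NormedSpace ℝ V]
    [FiniteDimensional ℝ V] {f : V → ℝ} (hf : ContDiff ℝ ∞ f) {a : V} (h0 : fderiv ℝ f a = 0)
    (h2 : ∀ v, v ≠ 0 → fderiv ℝ (fderiv ℝ f) a v v < 0) : IsLocalMax f a := by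
  have hf' : ContDiff ℝ ∞ (fderiv ℝ f) := hf.fderiv_right le_rfl
  have hd := hf.differentiable (by simp)
  have hd' := hf'.differentiable (by simp)
  have hf'' : Continuous (fderiv ℝ (fderiv ℝ f)) := hf'.continuous_fderiv (by simp)
  have key : ∀ᶠ x in 𝓝 a, ∀ v ∈ Metric.sphere (0 : V) 1, fderiv ℝ (fderiv ℝ f) x v v < 0 := by
    refine (isCompact_sphere (0 : V) 1).eventually_forall_of_forall_eventually fun v hv => ?_
    have hc : Continuous fun z : V × V => fderiv ℝ (fderiv ℝ f) z.1 z.2 z.2 := by fun_prop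
    exact hc.continuousAt.eventually_lt_const (h2 v (Metric.ne_of_mem_sphere hv one_ne_zero))
  obtain ⟨r, hr, hball⟩ := Metric.eventually_nhds_iff.1 key
  have hneg : ∀ x, dist x a < r → ∀ v, fderiv ℝ (fderiv ℝ f) x v v ≤ 0 := by
    intro x hx v
    rcases eq_or_ne v 0 with rfl | hv
    · simp
    have hn : 0 < ‖v‖ := norm_pos_iff.2 hv
    have h := hball hx (‖v‖⁻¹ • v) (by simp [norm_smul, hn.ne'])
    simp only [map_smul, smul_apply, smul_eq_mul] at h
    have h3 : 0 < ‖v‖⁻¹ := inv_pos.2 hn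
    exact ((pos_iff_neg_of_mul_neg (a := ‖v‖⁻¹) (by nlinarith)).1 h3).le
  refine Metric.eventually_nhds_iff.2 ⟨r, hr, fun x hx => ?_⟩
  have hl : ∀ t : ℝ, HasDerivAt (fun t : ℝ => a + t • (x - a)) (x - a) t := fun t => by
    simpa using ((hasDerivAt_id t).smul_const (x - a)).const_add a
  have hg : ∀ t : ℝ, HasDerivAt (fun t : ℝ => f (a + t • (x - a)))
      (fderiv ℝ f (a + t • (x - a)) (x - a)) t := fun t =>
    HasFDerivAt.comp_hasDerivAt (l := f) t (hd _).hasFDerivAt (hl t)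
  have hg' : ∀ t : ℝ, HasDerivAt (fun t : ℝ => fderiv ℝ f (a + t • (x - a)) (x - a))
      (fderiv ℝ (fderiv ℝ f) (a + t • (x - a)) (x - a) (x - a)) t := fun t => by
    have := HasFDerivAt.comp_hasDerivAt (l := fderiv ℝ f) t (hd' _).hasFDerivAt (hl t)
    simpa using this.clm_apply (hasDerivAt_const t (x - a))
  -- Two applications of the mean value theorem write `f x - f a` as `t` times a second derivative
  -- at a point of the segment.
  obtain ⟨t, ht, h3⟩ := exists_hasDerivAt_eq_slope _ _ (zero_lt_one' ℝ)
    (fun t _ => (hg t).continuousAt.continuousWithinAt) fun t _ => hg t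
  obtain ⟨u, hu, h4⟩ := exists_hasDerivAt_eq_slope _ _ ht.1
    (fun t _ => (hg' t).continuousAt.continuousWithinAt) fun t _ => hg' t
  simp only [zero_smul, add_zero, h0, zero_apply, sub_zero, one_smul, add_sub_cancel, div_one]
    at h3 h4
  have h5 := hneg (a + u • (x - a)) (by
    rw [dist_eq_norm, add_sub_cancel_left, norm_smul, Real.norm_of_nonneg hu.1.le]
    rw [dist_eq_norm] at hx
    nlinarith [norm_nonneg (x - a), hu.1, hu.2, ht.2]) (x - a)
  rw [h4, div_le_iff₀ ht.1, zero_mul] at h5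
  linarith

section Form

variable {ι : Type*} [Fintype ι] {H : (ι → ℝ) →L[ℝ] (ι → ℝ) →L[ℝ] ℝ} {κ : ℝ}

/-- The maximal dimension of a subspace on which a form is negative definite. -/
def negativeIndex (H : (ι → ℝ) →L[ℝ] (ι → ℝ) →L[ℝ] ℝ) : ℕ :=
  sSup {d | ∃ W : Submodule ℝ (ι → ℝ), Module.finrank ℝ W = d ∧ ∀ v ∈ W, v ≠ 0 → H v v < 0}

theorem negativeIndex_bddAbove (H : (ι → ℝ) →L[ℝ] (ι → ℝ) →L[ℝ] ℝ) :
    Fintype.card ι ∈ upperBounds {d | ∃ W : Submodule ℝ (ι → ℝ),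
      Module.finrank ℝ W = d ∧ ∀ v ∈ W, v ≠ 0 → H v v < 0} := by
  rintro d ⟨W, rfl, -⟩
  simpa using Submodule.finrank_le W

/-- A vector in the kernel pairs to zero with `1`, so it has sum zero, and there the form is
definite. -/
theorem nondegenerate_of_one_eigenvector (h1 : ∀ v, H 1 v = κ * ∑ i, v i)
    (hsymm : ∀ u v, H u v = H v u) (hneg : ∀ v, v ≠ 0 → ∑ i, v i = 0 → H v v < 0) (hκ : κ ≠ 0)
    {v : ι → ℝ} (hv : ∀ w, H v w = 0) : v = 0 := by
  by_contra hne
  have h := hv 1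
  rw [hsymm, h1, mul_eq_zero, or_iff_right hκ] at h
  exact (hneg v hne h).ne (hv v)

theorem negativeIndex_of_neg (h : ∀ v, v ≠ 0 → H v v < 0) : negativeIndex H = Fintype.card ι := by
  refine IsGreatest.csSup_eq ⟨⟨⊤, by simp, fun v _ => h v⟩, negativeIndex_bddAbove H⟩

variable [Nonempty ι]

/-- The line through `1` and the sum-zero hyperplane are orthogonal for the form, which is negative
on each. -/
theorem neg_of_one_eigenvector (h1 : ∀ v, H 1 v = κ * ∑ i, v i)
    (hsymm : ∀ u v, H u v = H v u) (hneg : ∀ v, v ≠ 0 → ∑ i, v i = 0 → H v v < 0) (hκ : κ < 0)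
    {v : ι → ℝ} (hv : v ≠ 0) : H v v < 0 := by
  have hn : (0 : ℝ) < Fintype.card ι := by exact_mod_cast Fintype.card_pos
  set a : ℝ := (∑ i, v i) / Fintype.card ι with ha
  have hw : ∑ i, (v - a • 1) i = 0 := by
    simp [ha, mul_div_cancel₀ _ hn.ne']
  have hdec : H v v = a ^ 2 * (κ * Fintype.card ι) + H (v - a • 1) (v - a • 1) := by
    have h2 : v = a • 1 + (v - a • 1) := by simp
    conv_lhs => rw [h2]
    simp only [map_add, map_smul, add_apply, smul_apply, smul_eq_mul]
    rw [hsymm (v - a • 1) 1, h1, h1, hw]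
    simp
    ring
  rw [hdec]
  have h3 : κ * Fintype.card ι < 0 := mul_neg_of_neg_of_pos hκ hn
  rcases eq_or_ne (v - a • 1) 0 with h | h
  · have ha0 : a ≠ 0 := fun h0 => hv (by simpa [h0] using h)
    rw [h]
    simpa using mul_neg_of_pos_of_neg (by positivity) h3
  · have := hneg _ h hw
    nlinarith [sq_nonneg a]

/-- The sum-zero hyperplane attains the bound; a negative definite subspace of full dimension would
contain `1`. -/
theorem negativeIndex_of_one_pos (h1 : 0 ≤ H 1 1)
    (hneg : ∀ v, v ≠ 0 → ∑ i, v i = 0 → H v v < 0) :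
    negativeIndex H = Fintype.card ι - 1 := by
  refine IsGreatest.csSup_eq ⟨?_, ?_⟩
  · let σ : Module.Dual ℝ (ι → ℝ) := ∑ i, LinearMap.proj i
    have hσ : ∀ v, σ v = ∑ i, v i := fun v => by simp [σ]
    have hσ0 : σ ≠ 0 := fun h => by
      have := hσ 1
      simp [h, eq_comm, Fintype.card_ne_zero] at this
    refine ⟨LinearMap.ker σ, ?_, fun v hv hv0 => hneg v hv0 ?_⟩
    · have := Module.Dual.finrank_ker_add_one_of_ne_zero hσ0
      rw [Module.finrank_fintype_fun_eq_card] at this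
      omega
    · rwa [LinearMap.mem_ker, hσ] at hv
  · rintro d ⟨W, hW, hWneg⟩
    have hle := negativeIndex_bddAbove H ⟨W, hW, hWneg⟩
    refine Nat.le_sub_one_of_lt (lt_of_le_of_ne hle fun hd => ?_)
    have htop : W = ⊤ := Submodule.eq_top_of_finrank_eq (by
      rw [hW, hd, Module.finrank_fintype_fun_eq_card])
    exact (hWneg 1 (htop ▸ Submodule.mem_top) one_ne_zero).not_ge h1

end Form

section LocalMax
variable {p : ℕ} [NeZero p]

/-- The angular parametrization and its right inverse, the argument of `y i / x i`, are both
continuous at the base point, so each direction is a composition. -/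
theorem isLocalMax_perimeter_iff {e : Circle → Plane} {x : Polygon p} :
    IsLocalMax (perimeter e) x ↔ IsLocalMax (localPerimeter e x) 0 := by
  constructor
  · intro h
    have hc : Continuous fun (t : ZMod p → ℝ) i => x i * Circle.exp (t i) := by fun_prop
    refine IsLocalMax.comp_continuous (f := perimeter e)
      (g := fun (t : ZMod p → ℝ) i => x i * Circle.exp (t i)) (b := 0) ?_ hc.continuousAt
    simpa using h
  · intro h
    have hc : ContinuousAt (fun (y : Polygon p) i => Complex.arg ((y i / x i : Circle) : ℂ)) x := by
      refine continuousAt_pi.2 fun i => ?_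
      refine ContinuousAt.comp (g := Complex.arg)
        (f := fun y : Polygon p => ((y i / x i : Circle) : ℂ)) ?_ ?_
      · exact Complex.continuousAt_arg (by simp)
      · have h1 : Continuous fun z : Circle => ((z / x i : Circle) : ℂ) := by fun_prop
        exact (h1.comp (continuous_apply i)).continuousAt
    have h0 : (fun i => Complex.arg ((x i / x i : Circle) : ℂ)) = 0 := by
      ext; simp
    have h1 := IsLocalMax.comp_continuous (f := localPerimeter e x)
      (g := fun (y : Polygon p) i => Complex.arg ((y i / x i : Circle) : ℂ)) (b := x)
      (by simpa only [h0] using h) hc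
    have h2 : localPerimeter e x ∘ (fun (y : Polygon p) i => Complex.arg ((y i / x i : Circle) : ℂ))
        = perimeter e := by
      ext y
      simp only [Function.comp_apply, localPerimeter, Circle.exp_arg, mul_div_cancel]
    rwa [h2] at h1

theorem isLocalMax_perimeter_starPolygon_iff {ε : ℝ} (hε : |ε| < 1) {k : ZMod p} {s : ZMod p → ℝ}
    (hs : s ∈ liftInterior k) :
    IsLocalMax (perimeter (deformedCircle p ε)) (starPolygon k s) ↔
      IsLocalMax (liftedPerimeter k ε) s := by
  rw [isLocalMax_perimeter_iff]
  have h := localPerimeter_starPolygon hε hs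
  constructor
  · intro hm
    have h1 : IsLocalMax (fun t => liftedPerimeter k ε (s + t)) (s - s) := by
      rw [sub_self]
      exact (h.isLocalMax_iff).1 hm
    have := IsLocalMax.comp_continuous (g := fun t => t - s) h1 (by fun_prop)
    simpa [Function.comp_def] using this
  · intro hm
    refine (h.isLocalMax_iff).2 ?_
    refine IsLocalMax.comp_continuous (f := liftedPerimeter k ε) (g := fun t => s + t) (b := 0) ?_
      (by fun_prop)
    simpa using hm

end LocalMax

end

/-! ### Classification of the critical polygons. -/

section

open Real Filter Topology

section Critical
variable {p : ℕ} [NeZero p] {ε : ℝ}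

/-- The regular polygon of winding number `k` with initial vertex at the angle `c`. -/
def regularPolygon (k : ZMod p) (c : ℝ) : Polygon p := starPolygon k fun _ => c

/-- Critical lifts are constant, and the Hessian at constant lifts is transversally negative. -/
def IsConcave (p : ℕ) [NeZero p] (ε : ℝ) : Prop :=
  ∀ k : ZMod p, k ≠ 0 → (∀ s ∈ liftDomain k, fderiv ℝ (liftedPerimeter k ε) s = 0 →
      ∀ i, s i = s 0) ∧
    ∀ c ∈ Set.Icc 0 (2 * π), ∀ v : ZMod p → ℝ, v ≠ 0 → ∑ i, v i = 0 →
      fderiv ℝ (fderiv ℝ (liftedPerimeter k ε)) (fun _ => c) v v < 0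

theorem eventually_isConcave (p : ℕ) [NeZero p] : ∀ᶠ ε in 𝓝 (0 : ℝ), IsConcave p ε :=
  eventually_all.2 fun _ => eventually_imp_distrib_left.2 eventually_critical_const

theorem sin_half_rootAngle_pos {k : ZMod p} (hk : k ≠ 0) : 0 < sin (rootAngle k / 2) :=
  sin_pos_of_pos_of_lt_pi (by linarith [rootAngle_pos hk]) (by linarith [rootAngle_lt k])

theorem isCriticalPolygon_regularPolygon_iff (hε0 : 0 < ε) (hε1 : ε < 1) {k : ZMod p} (hk : k ≠ 0)
    (c : ℝ) : IsCriticalPolygon (deformedCircle p ε) (regularPolygon k c) ↔ sin (p * c) = 0 := by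
  have hε : |ε| < 1 := by rwa [abs_of_pos hε0]
  have hp : (p : ℝ) ≠ 0 := by exact_mod_cast NeZero.ne p
  rw [regularPolygon, isCriticalPolygon_starPolygon_iff hε (const_mem_liftInterior hk c)]
  constructor
  · intro h
    have h1 := fderiv_liftedPerimeter_const hk hε c fun _ => 1
    rw [h] at h1
    simpa [hp, hε0.ne', (sin_half_rootAngle_pos hk).ne'] using h1
  · intro h
    ext1 v
    rw [fderiv_liftedPerimeter_const hk hε, h]
    simp

theorem exists_eq_regularPolygon (hε0 : 0 < ε) (hε1 : ε < 1) (hconc : IsConcave p ε) {x : Polygon p}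
    (hx : IsCriticalPolygon (deformedCircle p ε) x) :
    ∃ k : ZMod p, k ≠ 0 ∧ ∃ c ∈ Set.Icc 0 (2 * π), sin (p * c) = 0 ∧ regularPolygon k c = x := by
  have hε : |ε| < 1 := by rwa [abs_of_pos hε0]
  obtain ⟨k, hk, s, hs, hs', rfl⟩ := exists_starPolygon_eq hx.1
  have h := (hconc k hk).1 s hs ((isCriticalPolygon_starPolygon_iff hε hs').1 hx)
  have hsc : s = fun _ => s 0 := funext h
  refine ⟨k, hk, s 0, hs.1, ?_, by rw [regularPolygon, ← hsc]⟩
  rw [← isCriticalPolygon_regularPolygon_iff hε0 hε1 hk, regularPolygon, ← hsc]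
  exact hx

theorem hessian_regularPolygon_one (hε : |ε| < 1) {k : ZMod p} (hk : k ≠ 0) (c : ℝ)
    (v : ZMod p → ℝ) : hessian (deformedCircle p ε) (regularPolygon k c) 1 v =
      2 * sin (rootAngle k / 2) * ε * p ^ 2 * cos (p * c) * ∑ i, v i := by
  rw [regularPolygon, hessian_starPolygon hε (const_mem_liftInterior hk c)]
  exact fderiv_fderiv_liftedPerimeter_const hk hε c v

theorem hessian_regularPolygon_symm (hε : |ε| < 1) {k : ZMod p} (hk : k ≠ 0) (c : ℝ)
    (u v : ZMod p → ℝ) : hessian (deformedCircle p ε) (regularPolygon k c) u v =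
      hessian (deformedCircle p ε) (regularPolygon k c) v u := by
  rw [regularPolygon, hessian_starPolygon hε (const_mem_liftInterior hk c)]
  exact fderiv_fderiv_liftedPerimeter_symm k hε _ u v

theorem hessian_regularPolygon_neg (hε : |ε| < 1) (hconc : IsConcave p ε) {k : ZMod p} (hk : k ≠ 0)
    {c : ℝ} (hc : c ∈ Set.Icc 0 (2 * π)) {v : ZMod p → ℝ} (hv : v ≠ 0) (hsum : ∑ i, v i = 0) :
    hessian (deformedCircle p ε) (regularPolygon k c) v v < 0 := by
  rw [regularPolygon, hessian_starPolygon hε (const_mem_liftInterior hk c)]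
  exact (hconc k hk).2 c hc v hv hsum

theorem morseIndex_eq_negativeIndex (e : Circle → Plane) (x : Polygon p) :
    morseIndex e x = negativeIndex (hessian e x) := rfl

theorem isNondegenerate_regularPolygon (hε0 : 0 < ε) (hε1 : ε < 1) (hconc : IsConcave p ε)
    {k : ZMod p} (hk : k ≠ 0) {c : ℝ} (hc : c ∈ Set.Icc 0 (2 * π)) (hsin : sin (p * c) = 0) :
    IsNondegenerate (deformedCircle p ε) (regularPolygon k c) := by
  have hε : |ε| < 1 := by rwa [abs_of_pos hε0]
  have hp : (p : ℝ) ≠ 0 := by exact_mod_cast NeZero.ne p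
  have hcos : cos (p * c) ≠ 0 := by rcases sin_eq_zero_iff_cos_eq.1 hsin with h | h <;> norm_num [h]
  have hs := sin_half_rootAngle_pos hk
  exact fun v => nondegenerate_of_one_eigenvector (hessian_regularPolygon_one hε hk c)
    (hessian_regularPolygon_symm hε hk c) (fun v => hessian_regularPolygon_neg hε hconc hk hc)
    (by positivity)

theorem hessian_regularPolygon_neg_of_cos (hε0 : 0 < ε) (hε1 : ε < 1) (hconc : IsConcave p ε)
    {k : ZMod p} (hk : k ≠ 0) {c : ℝ} (hc : c ∈ Set.Icc 0 (2 * π)) (hcos : cos (p * c) = -1)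
    {v : ZMod p → ℝ} (hv : v ≠ 0) :
    hessian (deformedCircle p ε) (regularPolygon k c) v v < 0 := by
  have hε : |ε| < 1 := by rwa [abs_of_pos hε0]
  have hp : (p : ℝ) ≠ 0 := by exact_mod_cast NeZero.ne p
  have hs := sin_half_rootAngle_pos hk
  refine neg_of_one_eigenvector (hessian_regularPolygon_one hε hk c)
    (hessian_regularPolygon_symm hε hk c) (fun v => hessian_regularPolygon_neg hε hconc hk hc)
    ?_ hv
  rw [hcos, mul_neg_one, neg_lt_zero]
  positivity

theorem morseIndex_regularPolygon_iff (hε0 : 0 < ε) (hε1 : ε < 1) (hconc : IsConcave p ε)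
    {k : ZMod p} (hk : k ≠ 0) {c : ℝ} (hc : c ∈ Set.Icc 0 (2 * π)) (hsin : sin (p * c) = 0) :
    morseIndex (deformedCircle p ε) (regularPolygon k c) = p - 1 ↔ cos (p * c) = 1 := by
  have hε : |ε| < 1 := by rwa [abs_of_pos hε0]
  rw [morseIndex_eq_negativeIndex]
  rcases sin_eq_zero_iff_cos_eq.1 hsin with hcos | hcos
  · refine iff_of_true ?_ hcos
    rw [negativeIndex_of_one_pos, ZMod.card]
    · rw [hessian_regularPolygon_one hε hk, hcos]
      have hs := sin_half_rootAngle_pos hk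
      simp only [Pi.one_apply, Finset.sum_const, nsmul_eq_mul, mul_one]
      positivity
    · exact fun v => hessian_regularPolygon_neg hε hconc hk hc
  · refine iff_of_false ?_ (by norm_num [hcos])
    rw [negativeIndex_of_neg fun v =>
      hessian_regularPolygon_neg_of_cos hε0 hε1 hconc hk hc hcos, ZMod.card]
    -- The index is `p` here, and differs from the truncated `p - 1` because `p ≠ 0`.
    have := NeZero.ne p
    omega

theorem isLocalMax_regularPolygon_iff (hε0 : 0 < ε) (hε1 : ε < 1) (hconc : IsConcave p ε)
    {k : ZMod p} (hk : k ≠ 0) {c : ℝ} (hc : c ∈ Set.Icc 0 (2 * π)) (hsin : sin (p * c) = 0) :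
    IsLocalMax (perimeter (deformedCircle p ε)) (regularPolygon k c) ↔ cos (p * c) = -1 := by
  have hε : |ε| < 1 := by rwa [abs_of_pos hε0]
  have hmem := const_mem_liftInterior hk c
  have hp : (0 : ℝ) < p := by exact_mod_cast Nat.pos_of_ne_zero (NeZero.ne p)
  have hs := sin_half_rootAngle_pos hk
  rw [regularPolygon, isLocalMax_perimeter_starPolygon_iff hε hmem]
  constructor
  · intro h
    refine (sin_eq_zero_iff_cos_eq.1 hsin).resolve_left fun hcos => ?_
    -- If `cos (p c) = 1`, rotating the polygon by a small angle strictly increases its perimeter.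
    have h1 : IsLocalMax (fun x : ℝ => liftedPerimeter k ε fun _ => c + x) 0 := by
      refine IsLocalMax.comp_continuous (f := liftedPerimeter k ε)
        (g := fun (x : ℝ) (_ : ZMod p) => c + x) (b := 0) ?_ (by fun_prop)
      simpa using h
    have h2 : ∀ᶠ x in 𝓝[>] (0 : ℝ), x ∈ Set.Ioo 0 (π / p) := Ioo_mem_nhdsGT (by positivity)
    obtain ⟨x, hx, hx1⟩ := (h2.and (nhdsWithin_le_nhds h1)).exists
    simp only [liftedPerimeter_const hk hε, mul_add, cos_add, hsin, hcos] at hx1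
    have h3 : p * x < π := by
      rw [mul_comm]
      exact (lt_div_iff₀ hp).1 hx.2
    have h4 : cos (p * x) < cos 0 :=
      cos_lt_cos_of_nonneg_of_le_pi le_rfl h3.le (mul_pos hp hx.1)
    rw [cos_zero] at h4
    have h5 := le_of_mul_le_mul_left hx1 (by positivity)
    simp at h5
    nlinarith
  · intro hcos
    refine isLocalMax_of_fderiv_fderiv_neg (contDiff_liftedPerimeter k hε) ?_ fun v hv => ?_
    · ext1 v
      rw [fderiv_liftedPerimeter_const hk hε, hsin]
      simp
    · rw [← hessian_starPolygon hε hmem]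
      exact hessian_regularPolygon_neg_of_cos hε0 hε1 hconc hk hc hcos hv

end Critical

/-! ### Counting dihedral classes. -/

section Count
variable {p : ℕ} [Fact p.Prime]

/-- The class of a regular polygon in `(S¹)^p / D_p`. -/
def regularClass (k : ZMod p) (c : ℝ) : PolygonClass p :=
  Quotient.mk (dihedralSetoid p) (regularPolygon k c)

/-- The polygons differ by a rotation through `2π n / p`, which is the cyclic shift of indices by `n
/ k`; the division is possible since `p` is prime. -/
theorem regularClass_eq {k : ZMod p} (hk : k ≠ 0) {c c' : ℝ}
    (h : Circle.exp (p * c) = Circle.exp (p * c')) : regularClass k c = regularClass k c' := by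
  have hp : (p : ℝ) ≠ 0 := by exact_mod_cast NeZero.ne p
  obtain ⟨n, hn⟩ := Circle.exp_eq_exp.1 h
  have hc : Circle.exp c = ZMod.toCircle (n : ZMod p) * Circle.exp c' := by
    have h1 : ZMod.toCircle (n : ZMod p) = Circle.exp (2 * π * n / p) := by
      ext
      rw [ZMod.toCircle_intCast, Circle.coe_exp]
      push_cast
      congr 1
      ring
    rw [h1, ← Circle.exp_add]
    congr 1
    field_simp
    linear_combination hn
  refine (Quotient.sound (s := dihedralSetoid p) ⟨(n : ZMod p) / k, Or.inl fun i => ?_⟩).symm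
  rw [regularPolygon, regularPolygon, starPolygon, starPolygon, hc, mul_add, mul_div_cancel₀ _ hk,
    AddChar.map_add_eq_mul, mul_assoc]

theorem regularClass_neg (k : ZMod p) (c : ℝ) : regularClass (-k) c = regularClass k c := by
  refine (Quotient.sound (s := dihedralSetoid p) ⟨0, Or.inr fun i => ?_⟩).symm
  rw [regularPolygon, regularPolygon, starPolygon, starPolygon]
  simp

/-- The quotient of consecutive vertices recovers `k`, inverted if the indices are reflected, and
the `p`-th power of any vertex is `exp (i p c)`. -/
theorem eq_or_eq_neg_of_regularClass_eq {k k' : ZMod p} {c c' : ℝ}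
    (h : regularClass k c = regularClass k' c') :
    (k' = k ∨ k' = -k) ∧ Circle.exp (p * c) = Circle.exp (p * c') := by
  obtain ⟨a, h | h⟩ := Quotient.exact h
  · refine ⟨Or.inl ?_, ?_⟩
    · apply ZMod.injective_toCircle
      have h0 := h 0
      have h1 := h 1
      simp only [regularPolygon, starPolygon, mul_add, AddChar.map_add_eq_mul, mul_one, mul_zero,
        AddChar.map_zero_eq_one, one_mul] at h0 h1
      rw [h0, mul_assoc] at h1
      exact mul_right_cancel h1
    · rw [← starPolygon_pow k (fun _ => c) (0 + a), ← starPolygon_pow k' (fun _ => c') 0]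
      exact congrArg (· ^ p) (h 0).symm
  · refine ⟨Or.inr ?_, ?_⟩
    · apply ZMod.injective_toCircle
      have h0 := h 0
      have h1 := h 1
      simp only [regularPolygon, starPolygon, sub_eq_add_neg, AddChar.map_add_eq_mul,
        mul_one, mul_zero, AddChar.map_zero_eq_one, one_mul, neg_zero, mul_add, mul_neg] at h0 h1
      rw [h0, mul_comm (ZMod.toCircle (k * a)) (ZMod.toCircle (-k)), mul_assoc] at h1
      exact mul_right_cancel h1
    · rw [← starPolygon_pow k (fun _ => c) (a - 0), ← starPolygon_pow k' (fun _ => c') 0]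
      exact congrArg (· ^ p) (h 0).symm

theorem injOn_regularClass (c : ℝ) :
    Set.InjOn (fun m : ℕ => regularClass (m : ZMod p) c) (Set.Icc 1 ((p - 1) / 2)) := by
  intro m hm m' hm' h
  have hp := (Fact.out : p.Prime).pos
  obtain ⟨h1, h2⟩ := hm
  obtain ⟨h3, h4⟩ := hm'
  rcases (eq_or_eq_neg_of_regularClass_eq h).1 with h5 | h5
  · rw [ZMod.natCast_eq_natCast_iff', Nat.mod_eq_of_lt (by omega), Nat.mod_eq_of_lt (by omega)] at h5
    exact h5.symm
  -- Here `p` would divide `m' + m`, which lies strictly between `0` and `p`.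
  · rw [eq_neg_iff_add_eq_zero, ← Nat.cast_add, ZMod.natCast_eq_zero_iff] at h5
    have := Nat.le_of_dvd (by omega) h5
    omega

theorem exists_regularClass_natCast {k : ZMod p} (hk : k ≠ 0) (hp2 : Odd p) (c : ℝ) :
    ∃ m ∈ Set.Icc 1 ((p - 1) / 2), regularClass (m : ZMod p) c = regularClass k c := by
  have h0 : k.val ≠ 0 := (ZMod.val_ne_zero k).2 hk
  have h1 := ZMod.val_lt k
  obtain ⟨q, hq⟩ := hp2
  rcases le_or_gt k.val ((p - 1) / 2) with h | h
  · exact ⟨k.val, ⟨by omega, h⟩, by simp⟩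
  · refine ⟨p - k.val, ⟨by omega, by omega⟩, ?_⟩
    rw [Nat.cast_sub h1.le, ← regularClass_neg]
    simp

theorem exp_eq_of_cos_eq {x y : ℝ} (hx : sin x = 0) (hy : sin y = 0) (h : cos x = cos y) :
    Circle.exp x = Circle.exp y := by
  ext
  rw [Circle.coe_exp, Circle.coe_exp, Complex.exp_mul_I, Complex.exp_mul_I]
  norm_cast
  rw [h, hx, hy]

/-- For critical `c` the point `exp (i p c)` is determined by `cos (p c)`, so every class with the
property has a representative with initial angle `c₀`. Used with `c₀ = π` for maxima and `c₀ = 0`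
for index `p - 1`. -/
theorem criticalClasses_eq_image {ε : ℝ} (hε0 : 0 < ε) (hε1 : ε < 1) (hp2 : Odd p)
    (hconc : IsConcave p ε) {P : Polygon p → Prop} {c₀ : ℝ} (hc₀ : c₀ ∈ Set.Icc 0 (2 * π))
    (hsin : sin (p * c₀) = 0)
    (hP : ∀ k : ZMod p, k ≠ 0 → ∀ c ∈ Set.Icc 0 (2 * π), sin (p * c) = 0 →
      (P (regularPolygon k c) ↔ cos (p * c) = cos (p * c₀))) :
    criticalClasses (deformedCircle p ε) P =
      (fun m : ℕ => regularClass (m : ZMod p) c₀) '' Set.Icc 1 ((p - 1) / 2) := by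
  ext y
  constructor
  · rintro ⟨x, ⟨hx, hPx⟩, rfl⟩
    obtain ⟨k, hk, c, hc, hs, rfl⟩ := exists_eq_regularPolygon hε0 hε1 hconc hx
    obtain ⟨m, hm, h⟩ := exists_regularClass_natCast hk hp2 c₀
    refine ⟨m, hm, h.trans (regularClass_eq hk ?_)⟩
    exact (exp_eq_of_cos_eq hs hsin ((hP k hk c hc hs).1 hPx)).symm
  · rintro ⟨m, hm, rfl⟩
    have hm0 : (m : ZMod p) ≠ 0 := by
      rw [Ne, ZMod.natCast_eq_zero_iff]
      intro h
      have := Nat.le_of_dvd hm.1 h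
      have := hm.2
      have := (Fact.out : p.Prime).pos
      omega
    exact ⟨regularPolygon m c₀, ⟨(isCriticalPolygon_regularPolygon_iff hε0 hε1 hm0 c₀).2 hsin,
      (hP m hm0 c₀ hc₀ hsin).2 rfl⟩, rfl⟩

theorem ncard_image_regularClass (c : ℝ) :
    ((fun m : ℕ => regularClass (m : ZMod p) c) '' Set.Icc 1 ((p - 1) / 2)).ncard =
      (p - 1) / 2 := by
  rw [(injOn_regularClass c).ncard_image, ← Finset.coe_Icc, Set.ncard_coe_finset,
    Nat.card_Icc, Nat.add_sub_cancel]

end Count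

end

end Billiard

end


theorem mainTheorem7 (p : ℕ) [Fact p.Prime] (hp : Odd p) :
    ∃ ε₀ : ℝ, 0 < ε₀ ∧ ∀ ε : ℝ, 0 < ε → ε < ε₀ →
      Manifold.IsSmoothEmbedding (𝓡 1) 𝓘(ℝ, Billiard.Plane) ∞ (Billiard.deformedCircle p ε) ∧
      (∀ x : Billiard.Polygon p, Billiard.IsCriticalPolygon (Billiard.deformedCircle p ε) x →
        Billiard.IsNondegenerate (Billiard.deformedCircle p ε) x) ∧
      (Billiard.criticalClasses (p := p) (Billiard.deformedCircle p ε)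
        fun _ => True).ncard = p - 1 ∧
      (Billiard.criticalClasses (p := p) (Billiard.deformedCircle p ε)
        fun x => IsLocalMax (Billiard.perimeter (Billiard.deformedCircle p ε)) x).ncard
          = (p - 1) / 2 ∧
      (Billiard.criticalClasses (p := p) (Billiard.deformedCircle p ε)
        fun x => Billiard.morseIndex (Billiard.deformedCircle p ε) x = p - 1).ncard
          = (p - 1) / 2 := by
  open Billiard Real in
  obtain ⟨δ, hδ, hconc⟩ := Metric.eventually_nhds_iff.1 (eventually_isConcave p)
  refine ⟨min δ 1, lt_min hδ one_pos, fun ε hε0 hε => ?_⟩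
  have hε1 : ε < 1 := hε.trans_le (min_le_right _ _)
  have habs : |ε| < 1 := by rwa [abs_of_pos hε0]
  have hc : IsConcave p ε := hconc (by
    rw [dist_zero_right, Real.norm_of_nonneg hε0.le]
    exact hε.trans_le (min_le_left _ _))
  have h0 : (0 : ℝ) ∈ Set.Icc 0 (2 * π) := ⟨le_rfl, two_pi_pos.le⟩
  have hpi : π ∈ Set.Icc 0 (2 * π) := ⟨pi_pos.le, by linarith [pi_pos]⟩
  have hsin0 : sin (p * 0) = 0 := by simp
  have hcos0 : cos (p * 0) = 1 := by simp
  have hsinpi : sin (p * π) = 0 := sin_nat_mul_pi p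
  -- Oddness of `p` makes `π` a valid initial angle for the maxima.
  have hcospi : cos (p * π) = -1 := by rw [cos_nat_mul_pi, hp.neg_one_pow]
  have hmax := criticalClasses_eq_image (P := fun x => IsLocalMax (perimeter (deformedCircle p ε)) x)
    hε0 hε1 hp hc hpi hsinpi fun k hk c hc' hs => by
      rw [hcospi]; exact isLocalMax_regularPolygon_iff hε0 hε1 hc hk hc' hs
  have hind := criticalClasses_eq_image
    (P := fun x => morseIndex (deformedCircle p ε) x = p - 1) hε0 hε1 hp hc h0 hsin0
    fun k hk c hc' hs => by
      rw [hcos0]; exact morseIndex_regularPolygon_iff hε0 hε1 hc hk hc' hs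
  refine ⟨isSmoothEmbedding_deformedCircle p habs, fun x hx => ?_, ?_, ?_, ?_⟩
  · obtain ⟨k, hk, c, hc', hs, rfl⟩ := exists_eq_regularPolygon hε0 hε1 hc hx
    exact isNondegenerate_regularPolygon hε0 hε1 hc hk hc' hs
  · have hunion : criticalClasses (p := p) (deformedCircle p ε) (fun _ => True) =
        criticalClasses (deformedCircle p ε)
          (fun x => IsLocalMax (perimeter (deformedCircle p ε)) x) ∪
        criticalClasses (deformedCircle p ε)
          (fun x => morseIndex (deformedCircle p ε) x = p - 1) := by
      rw [criticalClasses, criticalClasses, criticalClasses, ← Set.image_union]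
      congr 1
      ext x
      refine ⟨fun hx => ?_, fun hx => ⟨hx.elim And.left And.left, trivial⟩⟩
      obtain ⟨k, hk, c, hc', hs, rfl⟩ := exists_eq_regularPolygon hε0 hε1 hc hx.1
      rcases sin_eq_zero_iff_cos_eq.1 hs with h | h
      · exact Or.inr ⟨hx.1, (morseIndex_regularPolygon_iff hε0 hε1 hc hk hc' hs).2 h⟩
      · exact Or.inl ⟨hx.1, (isLocalMax_regularPolygon_iff hε0 hε1 hc hk hc' hs).2 h⟩
    rw [hunion, hmax, hind, Set.ncard_union_eq ?_ ((Set.finite_Icc _ _).image _)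
      ((Set.finite_Icc _ _).image _), ncard_image_regularClass, ncard_image_regularClass]
    · obtain ⟨q, rfl⟩ := hp
      omega
    · rw [Set.disjoint_left]
      rintro _ ⟨m, -, rfl⟩ ⟨m', -, h⟩
      -- The invariant `exp (i p c)` separates the two families: its real part is `1` on one and
      -- `-1` on the other.
      have h1 := congrArg (fun z : Circle => (z : ℂ).re) (eq_or_eq_neg_of_regularClass_eq h).2
      simp only [Circle.coe_exp,
        Complex.exp_ofReal_mul_I_re, hcos0, hcospi] at h1
      norm_num at h1
  · rw [hmax, ncard_image_regularClass]
  · rw [hind, ncard_image_regularClass]
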